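/- **Conventions.** Let $\mathcal K$ be a 2-category (or bicategory) with a class of *small* objects; $G,G',D,X,Y$ below denote small objects. $\mathrm{Lan}$ denotes left extension: $\eta:g\Rightarrow h f$ exhibits $h$ as $\mathrm{Lan}_f g$ if pasting with $\eta$ gives a bijection between 2-cells $h\Rightarrow k$ and $g\Rightarrow kf$. *KZ-doctrines.* A relative KZ-doctrine $S$ consists of objects $SX$, units $\alpha_X:X\to SX$, and for each $f:X\to SY$ a 1-cell $L_f:SX\to SY$ with an invertible 2-cell $f\cong L_f\alpha_X$ exhibiting $L_f=\mathrm{Lan}_{\alpha_X}f$, such that every $L_g$ ($g:Y\to SZ$) preserves these extensions and $1_{SX}=\mathrm{Lan}_{\alpha_X}\alpha_X$ via the identity. For $f:X\to Y$ put $Sf=L_{\alpha_Yf}$. An object $A$ is *$S$-cocomplete* if each $\ell:G\to A$ has an extension $L=\mathrm{Lan}_{\alpha_G}\ell$ with invertible 2-cell and $L$ preserves $L_f=\mathrm{Lan}_{\alpha_D}f$ for all $f:D\to SG$. A 1-cell $f:A\to B$ out of an $S$-cocomplete $A$ is an *$S$-cell* if it preserves all $\mathrm{Lan}_{\alpha_G}\ell$,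 $\ell:G\to A$. $S$ is *climbable* if for every adjunction $L\dashv R$ with $L:SG\to SG'$ and $R$ an $S$-cell there is $l:G\to G'$ with $\alpha_{G'}l\cong L\alpha_G$. *Contexts.* A context $\mathfrak J:S\Rightarrow P$ consists of two relative KZ-doctrines $S$ (units $\alpha$) and $P$ (units $y$) on the small objects, and 1-cells $\mathfrak J_X:SX\to PX$, pseudonatural in $X$, with 2-cells $y_X\Rightarrow\mathfrak J_X\alpha_X$ compatible with the pseudonaturality and exhibiting $\mathfrak J_X=\mathrm{Lan}_{\alpha_X}y_X$, each $\mathfrak J_X$ being representably fully faithful; moreover $P$ underlies a Yoneda structure with Yoneda maps $y$, whose admissible objects are the small ones and for which all 1-cells with small domain are admissible. That is, there is a class of admissible 1-cells, closed under precomposition and containing all $y_A$, and for every $f:A\to B$ with $A$ small a 1-cell $B(f,1):B\to PA$ and a 2-cell $\chi^f:y_A\Rightarrow B(f,1)f$ exhibiting $B(f,1)=\mathrm{Lan}_fy_A$ and $f$ as an absolute left lifting of $y_A$ along $B(f,1)$; $1_{PA}=\mathrm{Lan}_{y_A}y_A$; and for $f:A\to B$, $g:B\to C$ with $A,B$ small,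 the pasting of $\chi^{y_Bf}$ and $\chi^g$ exhibits $PB(y_Bf,1)\cdot C(g,1)$ as $\mathrm{Lan}_{gf}y_A$. Finally this Yoneda structure has a nerve: $\mathrm{Lan}_{y_A}f\dashv B(f,1)$ whenever $f:A\to B$ with $A$ small and $B$ $P$-cocomplete. *Presentable objects.* $A$ is *$\mathfrak J$-presentable* if there are $G,G'$, an adjunction $L\dashv i:A\to PG$ with invertible counit, and an equivalence $SG'\simeq A$ such that $i$ (viewed on $SG'$) is, via the identity 2-cell, the left extension along $\alpha_{G'}$ of its restriction $i\alpha_{G'}$. *Gabriel–Ulmer envelopes.* A Gabriel–Ulmer envelope relative to $\mathfrak J$ is a relative KZ-doctrine $\widehat{(-)}$ with units $\iota_A:A\to\widehat A$, all $\widehat A$ small, with equivalences $e_A:S\widehat A\simeq PA$ such that $e_A\alpha_{\widehat A}\iota_A\cong y_A$ and $e_B\,S\widehat f\cong Pf\,e_A$ for $f:A\to B$ between small objects (where $Pf$ is the covariant action of the doctrine $P$). It is *absorbing* if, for $\widehat{(-)}$-cocomplete $G,G'$ and an equivalence $E:SG\simeq SG'$, every $l:G\to G'$ with $\alpha_{G'}l\cong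 E\alpha_G$ is an equivalence. Given an envelope, $\mathcal Rex(\mathfrak J)$ has as objects the small $\widehat{(-)}$-cocomplete objects, as 1-cells the $\widehat{(-)}$-cells, and all 2-cells; $\mathcal Lp(\mathfrak J)$ has as objects the $\mathfrak J$-presentable objects, as 1-cells the right adjoint 1-cells that are $S$-cells, and all 2-cells. $(-)^{\mathrm{coop}}$ reverses 1-cells and 2-cells. **Theorem (Gabriel–Ulmer duality).** Let $\mathfrak J:S\Rightarrow P$ be a context on $\mathcal K$ with $S$ climbable, and suppose given an absorbing Gabriel–Ulmer envelope relative to $\mathfrak J$. Then there is a biadjunction $$\mathfrak J\text{-}\mathrm{Mod}:\mathcal Rex(\mathfrak J)^{\mathrm{coop}}\rightleftarrows\mathcal Lp(\mathfrak J):\mathfrak J\text{-}\mathrm{Th},$$ i.e. pseudofunctors with pseudonatural unit $\eta$ and counit satisfying the triangle identities up to invertible 2-cells, such that the functors $\mathcal Lp(\mathfrak J)(\mathrm{Mod}\,X,A)\to\mathcal Rex(\mathfrak J)^{\mathrm{coop}}(X,\mathrm{Th}\,A)$, $g\mapsto \mathrm{Th}(g)\,\eta_X$, are equivalences; and it is a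 biequivalence: unit and counit are pointwise equivalences. Here, up to equivalence, $\mathfrak J\text{-}\mathrm{Mod}$ sends $G$ to $SG$, a 1-cell $F$ to a right adjoint of $SF$, and a 2-cell $\sigma$ to the mate of $S\sigma$. -/

import Mathlib

open CategoryTheory Bicategory

universe w v u w₁ v₁ u₁ w₂ v₂ u₂

namespace GabrielUlmer

/-! ### Left extensions, absolute left liftings, fully faithful 1-cells, equivalences

Composition is written in diagrammatic order: `f ≫ g` is "first `f`, then `g`".
A 2-category is a (strict) bicategory; everything is stated for bicategories. -/

section Basic

variable {K : Type u} [Bicategory.{w, v} K]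

/-- The 2-cell `η : g ⟶ f ≫ h` exhibits `h` as the left (Kan) extension of `g` along `f`. -/
def IsLeftExtension {X Y Z : K} {f : X ⟶ Y} {g : X ⟶ Z} {h : Y ⟶ Z} (η : g ⟶ f ≫ h) : Prop :=
  Nonempty (LeftExtension.IsKan (LeftExtension.mk h η))

lemma isLeftExtension_iff {X Y Z : K} {f : X ⟶ Y} {g : X ⟶ Z} {h : Y ⟶ Z} (η : g ⟶ f ≫ h) :
    IsLeftExtension η ↔ ∀ (k : Y ⟶ Z) (σ : g ⟶ f ≫ k), ∃! τ : h ⟶ k, η ≫ f ◁ τ = σ := by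
  constructor
  · rintro ⟨H⟩ k σ
    exact ⟨H.desc (LeftExtension.mk k σ), H.fac (LeftExtension.mk k σ),
      fun τ hτ => H.hom_ext (hτ.trans (H.fac (LeftExtension.mk k σ)).symm)⟩
  · intro H
    choose d hd hu using H
    exact ⟨LeftExtension.IsKan.mk
      (fun s => LeftExtension.homMk (d s.extension s.unit) (hd s.extension s.unit))
      (fun s τ => by
        apply StructuredArrow.hom_ext
        exact hu s.extension s.unit τ.right (LeftExtension.w τ))⟩

/-- The 1-cell `k` preserves the triangle `η : g ⟶ f ≫ h`: the whiskered 2-cell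
`g ≫ k ⟶ f ≫ (h ≫ k)` exhibits `h ≫ k` as the left extension of `g ≫ k` along `f`. -/
def PreservesExtension {X Y Z W : K} {f : X ⟶ Y} {g : X ⟶ Z} {h : Y ⟶ Z} (η : g ⟶ f ≫ h)
    (k : Z ⟶ W) : Prop :=
  IsLeftExtension (η ▷ k ≫ (α_ f h k).hom)

/-- The 2-cell `η : g ⟶ h ≫ f` exhibits `h` as the absolute left lifting of `g` along `f`. -/
def IsAbsLeftLifting {X Y Z : K} {f : Y ⟶ Z} {g : X ⟶ Z} {h : X ⟶ Y} (η : g ⟶ h ≫ f) : Prop :=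
  ∀ {T : K} (u : T ⟶ X), Nonempty (LeftLift.IsKan ((LeftLift.mk h η).whisker u))

/-- `f` is representably fully faithful. -/
def IsRepFullyFaithful {X Y : K} (f : X ⟶ Y) : Prop :=
  ∀ T : K, (postcomp T f).Full ∧ (postcomp T f).Faithful

/-- The 1-cell `f` is an equivalence. -/
def IsEquivalenceCell {X Y : K} (f : X ⟶ Y) : Prop :=
  ∃ e : X ≌ Y, e.hom = f

end Basic

/-! ### Relative KZ-doctrines -/

/-- A relative KZ-doctrine (relative left Kan pseudomonad) over the inclusion into `K` of the full
sub-2-category of the objects satisfying `small`. -/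
structure KZDoctrine (K : Type u) [Bicategory.{w, v} K] (small : K → Prop) where
  /-- the object `S X`, for `X` small -/
  obj : Subtype small → K
  /-- the unit `X ⟶ S X` -/
  unit : ∀ X : Subtype small, X.1 ⟶ obj X
  /-- the extension `S X ⟶ S Y` of `f : X ⟶ S Y` -/
  lan : ∀ {X Y : Subtype small}, (X.1 ⟶ obj Y) → (obj X ⟶ obj Y)
  /-- the invertible 2-cell filling the triangle -/
  cell : ∀ {X Y : Subtype small} (f : X.1 ⟶ obj Y), f ≅ unit X ≫ lan f
  isLeftExtension_cell : ∀ {X Y : Subtype small} (f : X.1 ⟶ obj Y), IsLeftExtension (cell f).hom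
  preserves : ∀ {X Y Z : Subtype small} (f : X.1 ⟶ obj Y) (g : Y.1 ⟶ obj Z),
    PreservesExtension (cell f).hom (lan g)
  isLeftExtension_id : ∀ X : Subtype small, IsLeftExtension (ρ_ (unit X)).inv

namespace KZDoctrine

variable {K : Type u} [Bicategory.{w, v} K] {small : K → Prop} (S : KZDoctrine K small)

/-- The action of (the pseudofunctor underlying) `S` on a 1-cell `f : X ⟶ Y` between small
objects: the extension of `f` followed by the unit of `Y`. -/
def map {X Y : Subtype small} (f : X.1 ⟶ Y.1) : S.obj X ⟶ S.obj Y :=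
  S.lan (f ≫ S.unit Y)

/-- The pseudonaturality square of the unit of `S`. -/
def mapCell {X Y : Subtype small} (f : X.1 ⟶ Y.1) : f ≫ S.unit Y ≅ S.unit X ≫ S.map f :=
  S.cell (f ≫ S.unit Y)

/-- The object `A` is `S`-cocomplete: every `l : G ⟶ A` with `G` small has a left extension `L`
along the unit `G ⟶ S G`, with invertible 2-cell, and `L` preserves the extension of every
`f : D ⟶ S G`. -/
def Cocomplete (A : K) : Prop :=
  ∀ (G : Subtype small) (l : G.1 ⟶ A), ∃ (L : S.obj G ⟶ A) (η : l ≅ S.unit G ≫ L),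
    IsLeftExtension η.hom ∧
      ∀ (D : Subtype small) (f : D.1 ⟶ S.obj G), PreservesExtension (S.cell f).hom L

/-- The 1-cell `f : A ⟶ B` is an `S`-cell: it preserves the left extension along the unit
`G ⟶ S G` of every `l : G ⟶ A` with `G` small. It is used only for `S`-cocomplete `A`, where
these extensions exist. -/
def IsCell {A B : K} (f : A ⟶ B) : Prop :=
  ∀ (G : Subtype small) (l : G.1 ⟶ A) (L : S.obj G ⟶ A) (η : l ⟶ S.unit G ≫ L),
    IsLeftExtension η → PreservesExtension η f

/-- The KZ-doctrine `S` is climbable: for every adjunction `L ⊣ R` with `L : S G ⟶ S G'` whose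
right adjoint is an `S`-cell, the left adjoint climbs along the units to a 1-cell `l : G ⟶ G'`. -/
def Climbable : Prop :=
  ∀ (G G' : Subtype small) (L : S.obj G ⟶ S.obj G') (R : S.obj G' ⟶ S.obj G),
    Nonempty (L ⊣ R) → S.IsCell R →
      ∃ l : G.1 ⟶ G'.1, Nonempty (l ≫ S.unit G' ≅ S.unit G ≫ L)

lemma isCell_id (A : K) : S.IsCell (𝟙 A) := by
  intro G l L η hη
  rw [isLeftExtension_iff] at hη
  refine (isLeftExtension_iff _).2 fun k σ => ?_
  obtain ⟨τ, h, u⟩ := hη k ((ρ_ l).inv ≫ σ)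
  refine ⟨(ρ_ L).hom ≫ τ, ?_, fun τ' h' => ?_⟩
  · refine (cancel_epi (ρ_ l).inv).1 ?_
    rw [← h]
    simp
  · rw [← cancel_epi (ρ_ L).inv, Iso.inv_hom_id_assoc]
    apply u
    simp [← h']

lemma isCell_comp {A B C : K} {f : A ⟶ B} {g : B ⟶ C} (hf : S.IsCell f) (hg : S.IsCell g) :
    S.IsCell (f ≫ g) := by
  intro G l L η hη
  have H := (isLeftExtension_iff _).1 (hg G (l ≫ f) (L ≫ f) _ (hf G l L η hη))
  refine (isLeftExtension_iff _).2 fun k σ => ?_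
  obtain ⟨τ, h, u⟩ := H k ((α_ l f g).hom ≫ σ)
  refine ⟨(α_ L f g).inv ≫ τ, ?_, fun τ' h' => ?_⟩
  · refine (cancel_epi (α_ l f g).hom).1 ?_
    rw [← h]
    simp
  · rw [← cancel_epi (α_ L f g).hom, Iso.hom_inv_id_assoc]
    apply u
    simp [← h']

end KZDoctrine

/-! ### Yoneda structures and Yoneda contexts -/

section Context

variable (K : Type u) [Bicategory.{w, v} K]

/-- A Yoneda structure on `K` underlain by the KZ-doctrine `P`: its admissible objects are the
small ones, its presheaf objects are the `P A` and its Yoneda maps are the units of `P`. -/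
structure YonedaStructure {small : K → Prop} (P : KZDoctrine K small) where
  /-- the right ideal of admissible 1-cells -/
  adm : ∀ {A B : K}, (A ⟶ B) → Prop
  adm_comp : ∀ {A B C : K} (f : A ⟶ B) (l : B ⟶ C), adm l → adm (f ≫ l)
  /-- an object is small exactly when it is admissible -/
  small_iff : ∀ A : K, small A ↔ adm (𝟙 A)
  adm_unit : ∀ A : Subtype small, adm (P.unit A)
  /-- the 1-cell `B(f, 1) : B ⟶ P A` -/
  nerve : ∀ {A : Subtype small} {B : K} (f : A.1 ⟶ B), adm f → (B ⟶ P.obj A)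
  /-- the 2-cell `χ^f` -/
  chi : ∀ {A : Subtype small} {B : K} (f : A.1 ⟶ B) (hf : adm f), P.unit A ⟶ f ≫ nerve f hf
  chi_isAbsLeftLifting : ∀ {A : Subtype small} {B : K} (f : A.1 ⟶ B) (hf : adm f),
    IsAbsLeftLifting (chi f hf)
  chi_isLeftExtension : ∀ {A : Subtype small} {B : K} (f : A.1 ⟶ B) (hf : adm f),
    IsLeftExtension (chi f hf)
  isLeftExtension_id : ∀ A : Subtype small, IsLeftExtension (ρ_ (P.unit A)).inv
  /-- with `P f := PB(f ≫ y_B, 1)`, the pasting of `χ^{f ≫ y_B}` and `χ^g` exhibits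
  `C(g, 1) ≫ P f` as the left extension of `y_A` along `f ≫ g` -/
  chi_pasting : ∀ {A B : Subtype small} {C : K} (f : A.1 ⟶ B.1) (g : B.1 ⟶ C) (hg : adm g),
    IsLeftExtension (f := f ≫ g)
      (h := nerve g hg ≫ nerve (f ≫ P.unit B) (adm_comp f _ (adm_unit B)))
      (chi (f ≫ P.unit B) (adm_comp f _ (adm_unit B)) ≫
        (f ◁ chi g hg) ▷ nerve (f ≫ P.unit B) (adm_comp f _ (adm_unit B)) ≫
        ((α_ f g (nerve g hg)).inv ▷ nerve (f ≫ P.unit B) (adm_comp f _ (adm_unit B))) ≫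
        (α_ (f ≫ g) (nerve g hg) (nerve (f ≫ P.unit B) (adm_comp f _ (adm_unit B)))).hom)

/-- A Yoneda context `J : S ⇒ P` on `K`. -/
structure YonedaContext where
  /-- the objects on which both doctrines are defined -/
  small : K → Prop
  S : KZDoctrine K small
  P : KZDoctrine K small
  /-- `P` underlies a Yoneda structure -/
  yoneda : YonedaStructure K P
  /-- the admissibles agree with the source of the doctrines: besides the admissible objects being
  the small ones, every 1-cell with small domain is admissible -/
  adm_of_small : ∀ {A : Subtype small} {B : K} (f : A.1 ⟶ B), yoneda.adm f
  /-- the Yoneda structure has a nerve: for a 1-cell `f : A ⟶ B` with `A` small and `B`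
  cocomplete, so that the Yoneda extension of `f` exists, this extension is left adjoint
  to `B(f, 1)` -/
  has_nerve : ∀ {A : Subtype small} {B : K} (f : A.1 ⟶ B) (L : P.obj A ⟶ B) (η : f ⟶ P.unit A ≫ L),
    P.Cocomplete B → IsLeftExtension η → Nonempty (L ⊣ yoneda.nerve f (adm_of_small f))
  /-- the components of `J` -/
  J : ∀ X : Subtype small, S.obj X ⟶ P.obj X
  /-- the 2-cell filling the triangle of the unit of `P`, the unit of `S` and `J` -/
  chi : ∀ X : Subtype small, P.unit X ⟶ S.unit X ≫ J X
  chi_isLeftExtension : ∀ X : Subtype small, IsLeftExtension (chi X)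
  J_fullyFaithful : ∀ X : Subtype small, IsRepFullyFaithful (J X)
  /-- pseudonaturality of `J` -/
  J_naturality : ∀ {X Y : Subtype small} (f : X.1 ⟶ Y.1), S.map f ≫ J Y ≅ J X ≫ P.map f
  /-- The pseudonaturality squares of `J` and of the two units are compatible with the triangles
  `chi`. Since `P.map f` is a left adjoint, `J X ≫ P.map f` is a left extension along the unit of
  `S`, so that this equation determines `J_naturality` and implies its coherence conditions. -/
  J_naturality_chi : ∀ {X Y : Subtype small} (f : X.1 ⟶ Y.1),
    f ◁ chi Y ≫ (α_ f (S.unit Y) (J Y)).inv ≫ (S.mapCell f).hom ▷ J Y ≫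
        (α_ (S.unit X) (S.map f) (J Y)).hom ≫ S.unit X ◁ (J_naturality f).hom =
      (P.mapCell f).hom ≫ chi X ▷ P.map f ≫ (α_ (S.unit X) (J X) (P.map f)).hom

variable {K}

/-- The object `A` is `J`-presentable: it is a left split subobject of some `P G` through an
adjunction `L ⊣ i`, it is equivalent to some `S G'`, and `i` is the left extension of its
restriction along the unit of `G'`. -/
def YonedaContext.Presentable (c : YonedaContext K) (A : K) : Prop :=
  ∃ (G : Subtype c.small) (L : c.P.obj G ⟶ A) (i : A ⟶ c.P.obj G) (adj : L ⊣ i),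
    IsIso adj.counit ∧
      ∃ (G' : Subtype c.small) (e : c.S.obj G' ≌ A),
        IsLeftExtension (𝟙 (c.S.unit G' ≫ e.hom ≫ i))

/-- A Gabriel-Ulmer envelope relative to the context: a KZ-doctrine `hat`, sending small objects
to small objects, which factors `P` along `S`, i.e. with equivalences `S (hat A) ≌ P A`
compatible with the Yoneda maps and natural in `A`. -/
structure GUEnvelope (c : YonedaContext K) where
  hat : KZDoctrine K c.small
  small_hat : ∀ A : Subtype c.small, c.small (hat.obj A)
  equiv : ∀ A : Subtype c.small, c.S.obj ⟨hat.obj A, small_hat A⟩ ≌ c.P.obj A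
  /-- the composite of the units `A ⟶ hat A ⟶ S (hat A)` with the equivalence is the Yoneda map -/
  unitIso : ∀ A : Subtype c.small,
    hat.unit A ≫ c.S.unit ⟨hat.obj A, small_hat A⟩ ≫ (equiv A).hom ≅ c.P.unit A
  /-- Naturality. Both 1-cells are left extensions along `A ⟶ S (hat A)`, so that an isomorphism
  between them can be chosen, uniquely, compatibly with `unitIso`, and is then coherent. -/
  naturality : ∀ {A B : Subtype c.small} (f : A.1 ⟶ B.1),
    Nonempty (c.S.map (X := ⟨hat.obj A, small_hat A⟩) (Y := ⟨hat.obj B, small_hat B⟩) (hat.map f) ≫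
      (equiv B).hom ≅ (equiv A).hom ≫ c.P.map f)

/-- The envelope is absorbing: for `hat`-cocomplete `G` and `G'`, a 1-cell `l : G ⟶ G'` obtained
by climbing from an equivalence `S G ≌ S G'` is an equivalence. -/
def GUEnvelope.Absorbing {c : YonedaContext K} (h : GUEnvelope c) : Prop :=
  ∀ (G G' : Subtype c.small), h.hat.Cocomplete G.1 → h.hat.Cocomplete G'.1 →
    ∀ (e : c.S.obj G ≌ c.S.obj G') (l : G.1 ⟶ G'.1),
      Nonempty (l ≫ c.S.unit G' ≅ c.S.unit G ≫ e.hom) → IsEquivalenceCell l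

end Context

/-! ### Locally full sub-bicategories and the dual `B^coop` -/

/-- A class of objects and a class of 1-cells, closed under identities and composition. -/
structure SubData (K : Type u) [Bicategory.{w, v} K] where
  ob : K → Prop
  mor : ∀ {X Y : K}, (X ⟶ Y) → Prop
  id_mem : ∀ X : K, mor (𝟙 X)
  comp_mem : ∀ {X Y Z : K} (f : X ⟶ Y) (g : Y ⟶ Z), mor f → mor g → mor (f ≫ g)

/-- The objects of the sub-bicategory with the given objects and 1-cells and all 2-cells. -/
@[ext]
structure SubBicat {K : Type u} [Bicategory.{w, v} K] (D : SubData K) where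
  obj : K
  property : D.ob obj

namespace SubBicat

variable {K : Type u} [Bicategory.{w, v} K] {D : SubData K}

/-- The 1-cells of the sub-bicategory. -/
@[ext]
structure Hom (X Y : SubBicat D) where
  hom : X.obj ⟶ Y.obj
  mem : D.mor hom

instance : CategoryStruct (SubBicat D) where
  Hom X Y := Hom X Y
  id X := ⟨𝟙 X.obj, D.id_mem _⟩
  comp f g := ⟨f.hom ≫ g.hom, D.comp_mem _ _ f.mem g.mem⟩

/-- The 2-cells of the sub-bicategory are all the 2-cells between the underlying 1-cells. -/
@[ext]
structure Hom₂ {X Y : SubBicat D} (f g : X ⟶ Y) where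
  hom : f.hom ⟶ g.hom

instance (X Y : SubBicat D) : Category (X ⟶ Y) where
  Hom f g := Hom₂ f g
  id f := ⟨𝟙 f.hom⟩
  comp a b := ⟨a.hom ≫ b.hom⟩

@[simp] lemma id_hom (X : SubBicat D) : Hom.hom (𝟙 X) = 𝟙 X.obj := rfl
@[simp] lemma comp_hom {X Y Z : SubBicat D} (f : X ⟶ Y) (g : Y ⟶ Z) :
    Hom.hom (f ≫ g) = f.hom ≫ g.hom := rfl
@[simp] lemma id_hom₂ {X Y : SubBicat D} (f : X ⟶ Y) : Hom₂.hom (𝟙 f) = 𝟙 f.hom := rfl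
@[simp] lemma comp_hom₂ {X Y : SubBicat D} {f g h : X ⟶ Y} (a : f ⟶ g) (b : g ⟶ h) :
    Hom₂.hom (a ≫ b) = a.hom ≫ b.hom := rfl
@[ext] lemma hom₂_ext {X Y : SubBicat D} {f g : X ⟶ Y} {a b : f ⟶ g} (h : a.hom = b.hom) :
    a = b := Hom₂.ext h

/-- An invertible 2-cell of the ambient bicategory, as one of the sub-bicategory. -/
@[simps]
def isoMk {X Y : SubBicat D} {f g : X ⟶ Y} (a : f.hom ≅ g.hom) : f ≅ g where
  hom := ⟨a.hom⟩
  inv := ⟨a.inv⟩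

instance : Bicategory (SubBicat D) where
  homCategory := inferInstance
  whiskerLeft f _ _ a := ⟨f.hom ◁ a.hom⟩
  whiskerRight a h := ⟨a.hom ▷ h.hom⟩
  associator f g h := isoMk (α_ f.hom g.hom h.hom)
  leftUnitor f := isoMk (λ_ f.hom)
  rightUnitor f := isoMk (ρ_ f.hom)
  whisker_exchange a b := by ext; simpa using whisker_exchange _ _

end SubBicat

/-- The objects of `B^coop`, the bicategory `B` with reversed 1-cells and reversed 2-cells. -/
@[ext]
structure Coop (B : Type u) where
  obj : B

namespace Coop

variable {B : Type u} [Bicategory.{w, v} B]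

/-- The 1-cells `X ⟶ Y` of `B^coop` are the 1-cells `Y ⟶ X` of `B`. -/
@[ext]
structure Hom (X Y : Coop B) where
  rev : Y.obj ⟶ X.obj

instance : CategoryStruct (Coop B) where
  Hom X Y := Hom X Y
  id X := ⟨𝟙 X.obj⟩
  comp f g := ⟨g.rev ≫ f.rev⟩

/-- The 2-cells `f ⟶ g` of `B^coop` are the 2-cells `g ⟶ f` of `B`. -/
@[ext]
structure Hom₂ {X Y : Coop B} (f g : X ⟶ Y) where
  rev : g.rev ⟶ f.rev

instance (X Y : Coop B) : Category (X ⟶ Y) where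
  Hom f g := Hom₂ f g
  id f := ⟨𝟙 f.rev⟩
  comp a b := ⟨b.rev ≫ a.rev⟩

@[simp] lemma id_rev (X : Coop B) : Hom.rev (𝟙 X) = 𝟙 X.obj := rfl
@[simp] lemma comp_rev {X Y Z : Coop B} (f : X ⟶ Y) (g : Y ⟶ Z) :
    Hom.rev (f ≫ g) = g.rev ≫ f.rev := rfl
@[simp] lemma id_rev₂ {X Y : Coop B} (f : X ⟶ Y) : Hom₂.rev (𝟙 f) = 𝟙 f.rev := rfl
@[simp] lemma comp_rev₂ {X Y : Coop B} {f g h : X ⟶ Y} (a : f ⟶ g) (b : g ⟶ h) :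
    Hom₂.rev (a ≫ b) = b.rev ≫ a.rev := rfl
@[ext] lemma hom₂_ext {X Y : Coop B} {f g : X ⟶ Y} {a b : f ⟶ g} (h : a.rev = b.rev) :
    a = b := Hom₂.ext h

/-- A 1-cell of `B`, as a 1-cell of `B^coop` in the opposite direction. -/
abbrev op {X Y : B} (f : X ⟶ Y) : Coop.mk Y ⟶ Coop.mk X := ⟨f⟩

/-- A 2-cell of `B`, as a 2-cell of `B^coop` in the opposite direction. -/
abbrev op₂ {X Y : B} {f g : X ⟶ Y} (a : f ⟶ g) : op g ⟶ op f := ⟨a⟩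

/-- An invertible 2-cell of `B`, as one of `B^coop`. -/
@[simps]
def isoMk {X Y : Coop B} {f g : X ⟶ Y} (a : g.rev ≅ f.rev) : f ≅ g where
  hom := ⟨a.hom⟩
  inv := ⟨a.inv⟩

instance : Bicategory (Coop B) where
  homCategory := inferInstance
  whiskerLeft f _ _ a := ⟨a.rev ▷ f.rev⟩
  whiskerRight a h := ⟨h.rev ◁ a.rev⟩
  associator f g h := isoMk (α_ h.rev g.rev f.rev)
  leftUnitor f := isoMk (ρ_ f.rev).symm
  rightUnitor f := isoMk (λ_ f.rev).symm
  whisker_exchange a b := by ext; simpa using whisker_exchange b.rev a.rev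

end Coop

/-! ### Biadjunctions and biequivalences -/

section Biadjunction

variable {B : Type u₁} [Bicategory.{w₁, v₁} B] {C : Type u₂} [Bicategory.{w₂, v₂} C]

/-- The component `X ⟶ G (F X)` of a pseudonatural transformation from the identity to `G F`. -/
abbrev unitApp {F : B ⥤ᵖ C} {G : C ⥤ᵖ B}
    (η : Pseudofunctor.StrongTrans (Pseudofunctor.id B) (F.comp G)) (X : B) :
    X ⟶ G.obj (F.obj X) :=
  η.app X

/-- The component `F (G A) ⟶ A` of a pseudonatural transformation from `F G` to the identity. -/
abbrev counitApp {F : B ⥤ᵖ C} {G : C ⥤ᵖ B}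
    (θ : Pseudofunctor.StrongTrans (G.comp F) (Pseudofunctor.id C)) (A : C) :
    F.obj (G.obj A) ⟶ A :=
  θ.app A

/-- The functor `C(F X, A) ⥤ B(X, G A)` sending `g` to `X ⟶ G F X ⟶ G A`. -/
def transpose {F : B ⥤ᵖ C} {G : C ⥤ᵖ B}
    (η : Pseudofunctor.StrongTrans (Pseudofunctor.id B) (F.comp G)) (X : B) (A : C) :
    (F.obj X ⟶ A) ⥤ (X ⟶ G.obj A) where
  obj g := unitApp η X ≫ G.map g
  map τ := unitApp η X ◁ G.map₂ τ
  map_id g := by rw [G.map₂_id, whiskerLeft_id]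
  map_comp a b := by rw [G.map₂_comp, whiskerLeft_comp]

/-- A biadjunction `F ⊣ G` between pseudofunctors: pseudonatural unit and counit, such that the
functors `C(F X, A) ⥤ B(X, G A)` induced by the unit are equivalences of categories
(automatically pseudonatural in `X` and `A`), and such that the unit and the counit satisfy the
triangle identities up to invertible 2-cells. -/
structure Biadjunction (F : B ⥤ᵖ C) (G : C ⥤ᵖ B) where
  unit : Pseudofunctor.StrongTrans (Pseudofunctor.id B) (F.comp G)
  counit : Pseudofunctor.StrongTrans (G.comp F) (Pseudofunctor.id C)
  isEquivalence : ∀ (X : B) (A : C), (transpose unit X A).IsEquivalence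
  left_triangle : ∀ X : B,
    Nonempty (F.map (unitApp unit X) ≫ counitApp counit (F.obj X) ≅ 𝟙 (F.obj X))
  right_triangle : ∀ A : C,
    Nonempty (unitApp unit (G.obj A) ≫ G.map (counitApp counit A) ≅ 𝟙 (G.obj A))

/-- A biadjunction is a biequivalence when its unit and its counit are pointwise equivalences. -/
def Biadjunction.IsBiequivalence {F : B ⥤ᵖ C} {G : C ⥤ᵖ B} (b : Biadjunction F G) : Prop :=
  (∀ X : B, IsEquivalenceCell (unitApp b.unit X)) ∧
    ∀ A : C, IsEquivalenceCell (counitApp b.counit A)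

end Biadjunction

/-! ### The bicategories `Rex(J)` and `Lp(J)` -/

section Duality

variable {K : Type u} [Bicategory.{w, v} K]

/-- The objects of `Rex(J)` are the (small) `hat`-cocomplete objects, its 1-cells the
`hat`-cells. -/
def GUEnvelope.rexData {c : YonedaContext K} (h : GUEnvelope c) : SubData K where
  ob G := c.small G ∧ h.hat.Cocomplete G
  mor f := h.hat.IsCell f
  id_mem := h.hat.isCell_id
  comp_mem _ _ := h.hat.isCell_comp

/-- The objects of `Lp(J)` are the `J`-presentable objects, its 1-cells the right adjoints that are
`S`-cells. -/
def YonedaContext.lpData (c : YonedaContext K) : SubData K where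
  ob := c.Presentable
  mor {X Y} r := (∃ l : Y ⟶ X, Nonempty (l ⊣ r)) ∧ c.S.IsCell r
  id_mem X := ⟨⟨𝟙 X, ⟨Bicategory.Adjunction.id X⟩⟩, c.S.isCell_id X⟩
  comp_mem := by
    rintro X Y Z f g ⟨⟨l, ⟨a⟩⟩, hf⟩ ⟨⟨m, ⟨b⟩⟩, hg⟩
    exact ⟨⟨m ≫ l, ⟨b.comp a⟩⟩, c.S.isCell_comp hf hg⟩

/-- The 2-category `Rex(J)`. -/
abbrev GUEnvelope.Rex {c : YonedaContext K} (h : GUEnvelope c) : Type _ := SubBicat h.rexData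

/-- The 2-category `Lp(J)`. -/
abbrev YonedaContext.Lp (c : YonedaContext K) : Type _ := SubBicat c.lpData

/-- The small object underlying an object of `Rex(J)`. -/
def GUEnvelope.Rex.toSmall {c : YonedaContext K} {h : GUEnvelope c} (G : h.Rex) :
    Subtype c.small :=
  ⟨G.obj, G.property.1⟩

/-- The pseudofunctor `M : Rex(J)^coop ⥤ Lp(J)` is "application of `S`": up to equivalence it sends
`G` to `S G`, a 1-cell `f : G ⟶ G'` to a right adjoint `S G' ⟶ S G` of `S f`, and a 2-cell
`σ : f ⟶ f'` to the mate of `S σ`, the unique 2-cell `S f ⟶ S f'` compatible with `σ` along the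
units. -/
def IsGivenByApplying {c : YonedaContext K} (h : GUEnvelope c)
    (M : Coop h.Rex ⥤ᵖ c.Lp) : Prop :=
  ∃ (e : ∀ G : h.Rex, c.S.obj G.toSmall ≌ (M.obj ⟨G⟩).obj)
    (adj : ∀ {G G' : h.Rex} (f : G ⟶ G'),
      (e G).inv ≫ c.S.map (X := G.toSmall) (Y := G'.toSmall) f.hom ≫ (e G').hom ⊣
        (M.map (Coop.op f)).hom),
    ∀ {G G' : h.Rex} {f f' : G ⟶ G'} (σ : f ⟶ f')
      (τ : c.S.map (X := G.toSmall) (Y := G'.toSmall) f.hom ⟶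
        c.S.map (X := G.toSmall) (Y := G'.toSmall) f'.hom),
      σ.hom ▷ c.S.unit G'.toSmall ≫
          (c.S.mapCell (X := G.toSmall) (Y := G'.toSmall) f'.hom).hom =
        (c.S.mapCell (X := G.toSmall) (Y := G'.toSmall) f.hom).hom ≫ c.S.unit G.toSmall ◁ τ →
      (M.map₂ (Coop.op₂ σ)).hom =
        conjugateEquiv (adj f') (adj f) ((e G).inv ◁ (τ ▷ (e G').hom))

end Duality

end GabrielUlmer

/-!
The duality follows from one fact about bicategories: a pseudofunctor which is a local equivalence
and which is surjective on objects up to equivalence is part of a biadjoint biequivalence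
(`exists_biadjunction_isBiequivalence`). A right biadjoint is built from biuniversal arrows, one
for each object of the target.

The pseudofunctor of models sends `G` to `S G` and `f` to a right adjoint of `S f`, and acts on
2-cells by taking conjugates (`rightAdjointPseudofunctor`). Since the units of `S` are fully
faithful, `S` is bijective on 2-cells, and so is the formation of conjugates. What remains concerns
objects and 1-cells.

* A small object `G` is cocomplete for the envelope exactly when its unit `ι : G ⟶ Ĝ` has a left
  adjoint (`KZDoctrine.Cocomplete.exists_adjunction`, `KZDoctrine.cocomplete_of_adjunction`). Then
  `S G` is a reflective subobject of `S Ĝ ≌ P G`, hence presentable.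
* If `A ≌ S G` is presentable, it is reflective in a presheaf object and hence `P`-cocomplete. So
  the nerve of the unit of `S G`, which is `J : S G ⟶ P G` and thus `S ι` up to equivalence, has a
  left adjoint. Climbing gives a left adjoint of `ι`
  (`GUEnvelope.exists_equivalence_of_presentable`).
* For every `f : X ⟶ Y`, the 1-cell `P f` has a right adjoint that is itself a left adjoint, and
  `S f̂` inherits this from `P f`. If `f` is a cell of the envelope, then `S f̂` followed by the
  reflection onto `S Y` is the reflection onto `S X` followed by `S f`, which gives a right adjoint
  of `S f` that is an `S`-cell (`GUEnvelope.exists_right_adjoint`).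
* Conversely, the left adjoint of an `S`-cell `S Y ⟶ S X` climbs to some `f : X ⟶ Y`. That `f` is
  a cell of the envelope rests on `GUEnvelope.extendsAlong_hat_unit`: a 1-cell out of `X̂` which
  climbs to a left adjoint out of `S X̂ ≌ P X` is the left extension of its restriction to `X`,
  because `P X` is free on `X` and all the units are fully faithful.
-/

namespace GabrielUlmer

/-! ### Biadjunctions from biuniversal arrows -/

namespace BiuniversalArrow

variable {B : Type u₁} [Bicategory.{w₁, v₁} B] {C : Type u₂} [Bicategory.{w₂, v₂} C]

/-- For a 1-cell `θ : F G₀ ⟶ c`, the functor `B(b, G₀) ⥤ C(F b, c)` sending `f` to `F f ≫ θ`. The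
1-cell `θ` is a biuniversal arrow from `F` to `c` when all these functors are equivalences. -/
def eval (F : B ⥤ᵖ C) {c : C} {G₀ : B} (θ : F.obj G₀ ⟶ c) (b : B) :
    (b ⟶ G₀) ⥤ (F.obj b ⟶ c) where
  obj f := F.map f ≫ θ
  map τ := F.map₂ τ ▷ θ

variable {F : B ⥤ᵖ C} {G₀ : C → B} {θ : ∀ c, F.obj (G₀ c) ⟶ c}
  (h : ∀ b c, (eval F (θ c) b).IsEquivalence)

lemma hom_ext (h : ∀ b c, (eval F (θ c) b).IsEquivalence) {b : B} {c : C} {x y : b ⟶ G₀ c}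
    {σ τ : x ⟶ y} (H : F.map₂ σ ▷ θ c = F.map₂ τ ▷ θ c) : σ = τ :=
  have := h b c
  (eval F (θ c) b).map_injective H

/-- The 1-cell `G₀ c ⟶ G₀ d` induced by `f : c ⟶ d`. -/
noncomputable def map {c d : C} (f : c ⟶ d) : G₀ c ⟶ G₀ d :=
  have := h (G₀ c) d
  (eval F (θ d) (G₀ c)).objPreimage (θ c ≫ f)

/-- The invertible 2-cell making `θ` natural. -/
noncomputable def mapIso {c d : C} (f : c ⟶ d) : F.map (map h f) ≫ θ d ≅ θ c ≫ f :=
  have := h (G₀ c) d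
  (eval F (θ d) (G₀ c)).objObjPreimageIso (θ c ≫ f)

/-- The 2-cell `x ⟶ y` determined by its image under `eval`. -/
noncomputable def lift {b : B} {c : C} {x y : b ⟶ G₀ c} (σ : F.map x ≫ θ c ⟶ F.map y ≫ θ c) :
    x ⟶ y :=
  have := h b c
  (eval F (θ c) b).preimage σ

@[simp]
lemma map₂_lift {b : B} {c : C} {x y : b ⟶ G₀ c} (σ : F.map x ≫ θ c ⟶ F.map y ≫ θ c) :
    F.map₂ (lift h σ) ▷ θ c = σ :=
  have := h b c
  (eval F (θ c) b).map_preimage σ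

/-- The invertible 2-cell `x ≅ y` determined by its image under `eval`. -/
@[simps]
noncomputable def liftIso {b : B} {c : C} {x y : b ⟶ G₀ c} (σ : F.map x ≫ θ c ≅ F.map y ≫ θ c) :
    x ≅ y where
  hom := lift h σ.hom
  inv := lift h σ.inv
  hom_inv_id := hom_ext h (by simp)
  inv_hom_id := hom_ext h (by simp)

/-- `mapIso` extended by a 1-cell on the left. -/
noncomputable def compMapIso {b : B} {c d : C} (x : b ⟶ G₀ c) (f : c ⟶ d) :
    F.map (x ≫ map h f) ≫ θ d ≅ (F.map x ≫ θ c) ≫ f :=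
  whiskerRightIso (F.mapComp x (map h f)) (θ d) ≪≫ α_ _ _ _ ≪≫
    whiskerLeftIso (F.map x) (mapIso h f) ≪≫ (α_ _ _ _).symm

lemma whiskerRight_map {a c d} {P Q : a ⟶ F.obj (G₀ c)} (τ : P ⟶ Q) (f : c ⟶ d) :
    τ ▷ F.map (map h f) ▷ θ d = (α_ _ _ _).hom ≫ P ◁ (mapIso h f).hom ≫ (α_ _ _ _).inv ≫
      τ ▷ θ c ▷ f ≫ (α_ _ _ _).hom ≫ Q ◁ (mapIso h f).inv ≫ (α_ _ _ _).inv := by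
  have := whisker_exchange τ (mapIso h f).hom
  rw [← cancel_mono (α_ _ _ _).hom, ← cancel_mono (Q ◁ (mapIso h f).hom),
    ← cancel_epi (α_ _ _ _).inv]
  simpa using this.symm

/-- The action of the right biadjoint on 2-cells. -/
noncomputable def map₂ {c d : C} {f g : c ⟶ d} (σ : f ⟶ g) :
    map (θ := θ) h f ⟶ map h g :=
  lift h ((mapIso h f).hom ≫ θ c ◁ σ ≫ (mapIso h g).inv)

/-- The unit constraint of the right biadjoint. -/
noncomputable def mapId (c : C) : map (θ := θ) h (𝟙 c) ≅ 𝟙 (G₀ c) :=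
  liftIso h (mapIso h (𝟙 c) ≪≫ ρ_ _ ≪≫ (λ_ _).symm ≪≫ whiskerRightIso (F.mapId _).symm (θ c))

/-- The composition constraint of the right biadjoint. -/
noncomputable def mapComp {c d e : C} (f : c ⟶ d) (g : d ⟶ e) :
    map (θ := θ) h (f ≫ g) ≅ map h f ≫ map h g :=
  liftIso h (mapIso h (f ≫ g) ≪≫ (α_ _ _ _).symm ≪≫
    whiskerRightIso (mapIso h f).symm g ≪≫ (compMapIso h (map h f) g).symm)

lemma map₂_whiskerLeft {c d e : C} (f : c ⟶ d) {g g' : d ⟶ e} (σ : g ⟶ g') :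
    map₂ (θ := θ) h (f ◁ σ) =
      (mapComp h f g).hom ≫ map h f ◁ map₂ h σ ≫ (mapComp h f g').inv := by
  apply hom_ext h
  have := whisker_exchange (mapIso h f).inv σ
  simp only [comp_whiskerLeft, Category.assoc] at this
  rw [← cancel_mono (α_ _ _ _).hom] at this
  simp only [Category.assoc, Iso.inv_hom_id, Category.comp_id] at this
  simp [compMapIso, map₂, mapComp, ← reassoc_of% this]

/-- The right biadjoint determined by biuniversal arrows. -/
noncomputable def rightBiadjoint : C ⥤ᵖ B where
  obj := G₀
  map f := map h f
  map₂ σ := map₂ h σ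
  map₂_id f := hom_ext h (by simp [map₂])
  map₂_comp σ τ := hom_ext h (by simp [map₂])
  mapId c := mapId h c
  mapComp f g := mapComp h f g
  map₂_whisker_left f _ _ σ := map₂_whiskerLeft h f σ
  map₂_whisker_right {c d e} f f' σ g := hom_ext h (by
    simp [compMapIso, whiskerRight_map, map₂, mapComp])
  map₂_associator f g k := hom_ext h (by simp [compMapIso, whiskerRight_map, map₂, mapComp])
  map₂_left_unitor f := hom_ext h (by
    simp [compMapIso, whiskerRight_map, map₂, mapComp, mapId])
  map₂_right_unitor f := hom_ext h (by simp [compMapIso, map₂, mapComp, mapId])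

lemma mapIso_comp {c d e : C} (f : c ⟶ d) (g : d ⟶ e) :
    (mapIso (θ := θ) h (f ≫ g)).hom ≫ θ c ◁ 𝟙 (f ≫ g) =
      (F.map₂ (mapComp h f g).hom ≫ (F.mapComp _ _).hom) ▷ θ e ≫ (α_ _ _ _).hom ≫
        F.map (map h f) ◁ (mapIso h g).hom ≫ (α_ _ _ _).inv ≫ (mapIso h f).hom ▷ g ≫
          (α_ _ _ _).hom := by
  simp [mapComp, compMapIso]

/-- The counit of the biadjunction. -/
noncomputable def counit :
    Pseudofunctor.StrongTrans ((rightBiadjoint h).comp F) (Pseudofunctor.id C) where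
  app c := θ c
  naturality f := mapIso h f
  naturality_naturality {c d f g} σ :=
    show F.map₂ (map₂ h σ) ▷ θ d ≫ (mapIso h g).hom = (mapIso h f).hom ≫ θ c ◁ σ by simp [map₂]
  naturality_id c :=
    show (mapIso h (𝟙 c)).hom ≫ θ c ◁ 𝟙 (𝟙 c) =
      (F.map₂ (mapId h c).hom ≫ (F.mapId _).hom) ▷ θ c ≫ (λ_ _).hom ≫ (ρ_ _).inv by simp [mapId]
  naturality_comp f g := mapIso_comp h f g

/-- The component `b ⟶ G (F b)` of the unit. -/
noncomputable def unitObj (b : B) : b ⟶ G₀ (F.obj b) :=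
  have := h b (F.obj b)
  (eval F (θ (F.obj b)) b).objPreimage (𝟙 (F.obj b))

/-- The first triangle identity. -/
noncomputable def unitObjIso (b : B) : F.map (unitObj h b) ≫ θ (F.obj b) ≅ 𝟙 (F.obj b) :=
  have := h b (F.obj b)
  (eval F (θ (F.obj b)) b).objObjPreimageIso (𝟙 (F.obj b))

/-- The transpose of `g`, evaluated, is `g`. -/
noncomputable def unitCompMapIso {b : B} {c : C} (g : F.obj b ⟶ c) :
    F.map (unitObj h b ≫ map h g) ≫ θ c ≅ g :=
  compMapIso h (unitObj h b) g ≪≫ whiskerRightIso (unitObjIso h b) g ≪≫ λ_ g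

lemma map₂_hom_inv_whiskerRight (F : B ⥤ᵖ C) {a b : B} {c : C} {x y : a ⟶ b} (e : x ≅ y)
    (g : F.obj b ⟶ c) : F.map₂ e.hom ▷ g ≫ F.map₂ e.inv ▷ g = 𝟙 _ := by
  rw [← comp_whiskerRight, ← PrelaxFunctor.map₂_comp]
  simp

lemma whiskerRight_comp_unit {a b c : C} {P Q : a ⟶ b} (τ : P ⟶ Q) {x : b ⟶ c} {y : c ⟶ b}
    (u : x ≫ y ⟶ 𝟙 b) :
    τ ▷ x ▷ y ≫ (α_ _ _ _).hom ≫ Q ◁ u ≫ (ρ_ _).hom =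
      (α_ _ _ _).hom ≫ P ◁ u ≫ (ρ_ _).hom ≫ τ := by
  have := whisker_exchange τ u
  rw [← cancel_epi (α_ _ _ _).inv, ← cancel_mono (ρ_ _).inv]
  simpa using this.symm

lemma unit_whiskerRight_comp {a b c : C} {P Q : a ⟶ b} (τ : P ⟶ Q) {x : a ⟶ c} {y : c ⟶ a}
    (u : x ≫ y ⟶ 𝟙 a) :
    x ◁ y ◁ τ ≫ (α_ _ _ _).inv ≫ u ▷ Q ≫ (λ_ _).hom =
      (α_ _ _ _).inv ≫ u ▷ P ≫ (λ_ _).hom ≫ τ := by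
  have := whisker_exchange u τ
  rw [← cancel_epi (α_ _ _ _).hom, ← cancel_mono (λ_ _).inv]
  simpa using this

lemma compMapIso_naturality {b : B} {c d : C} {x y : b ⟶ G₀ c} (σ : x ⟶ y) (f : c ⟶ d) :
    F.map₂ (σ ▷ map h f) ▷ θ d ≫ (compMapIso h y f).hom =
      (compMapIso h x f).hom ≫ F.map₂ σ ▷ θ c ▷ f := by
  simp [compMapIso, whiskerRight_map]

lemma compMapIso_comp {a b : B} {c d : C} (x : a ⟶ b) (y : b ⟶ G₀ c) (f : c ⟶ d) :
    F.map₂ (α_ x y (map h f)).inv ▷ θ d ≫ (compMapIso h (x ≫ y) f).hom =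
      (F.mapComp x (y ≫ map h f)).hom ▷ θ d ≫ (α_ _ _ _).hom ≫
        F.map x ◁ (compMapIso h y f).hom ≫ (α_ _ _ _).inv ≫ (α_ _ _ _).inv ▷ f ≫
          (F.mapComp x y).inv ▷ θ c ▷ f := by
  rw [← cancel_epi (F.map₂ (α_ x y (map h f)).hom ▷ θ d), ← comp_whiskerRight_assoc,
    ← PrelaxFunctor.map₂_comp]
  simp [compMapIso, whiskerRight_map]

/-- The transpose of `f ≫ unitObj`, evaluated, is `F f`. -/
noncomputable def compUnitIso {b b' : B} (f : b ⟶ b') :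
    F.map (f ≫ unitObj h b') ≫ θ (F.obj b') ≅ F.map f :=
  whiskerRightIso (F.mapComp f (unitObj h b')) _ ≪≫ α_ _ _ _ ≪≫
    whiskerLeftIso (F.map f) (unitObjIso h b') ≪≫ ρ_ _

lemma compUnitIso_naturality {b b' : B} {f g : b ⟶ b'} (σ : f ⟶ g) :
    F.map₂ (σ ▷ unitObj h b') ▷ θ (F.obj b') ≫ (compUnitIso h g).hom =
      (compUnitIso h f).hom ≫ F.map₂ σ := by
  simp [compUnitIso, whiskerRight_comp_unit]

lemma unitCompMapIso_naturality {b : B} {c : C} {f g : F.obj b ⟶ c} (σ : f ⟶ g) :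
    F.map₂ (unitObj h b ◁ map₂ h σ) ▷ θ c ≫ (unitCompMapIso h g).hom =
      (unitCompMapIso h f).hom ≫ σ := by
  simp [unitCompMapIso, compMapIso, map₂, unit_whiskerRight_comp]

lemma unitCompMapIso_id (b : B) :
    F.map₂ (unitObj h b ◁ (mapId h (F.obj b)).hom) ▷ θ (F.obj b) ≫ F.map₂ (ρ_ _).hom ▷ θ _ ≫
        (unitObjIso h b).hom = (unitCompMapIso h (𝟙 (F.obj b))).hom := by
  simp [unitCompMapIso, compMapIso, mapId]

lemma unitCompMapIso_comp {b : B} {c d : C} (f : F.obj b ⟶ c) (g : c ⟶ d) :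
    F.map₂ (unitObj h b ◁ (mapComp h f g).hom) ▷ θ d ≫ F.map₂ (α_ _ _ _).inv ▷ θ d ≫
        (compMapIso h (unitObj h b ≫ map h f) g).hom ≫ (unitCompMapIso h f).hom ▷ g =
      (unitCompMapIso h (f ≫ g)).hom := by
  rw [reassoc_of% (compMapIso_comp h)]
  simp [unitCompMapIso, compMapIso, mapComp]

lemma compUnitIso_id (b : B) :
    (compUnitIso (θ := θ) h (𝟙 b)).hom ≫ (F.mapId b).hom =
      F.map₂ (λ_ _).hom ▷ θ _ ≫ (unitObjIso h b).hom := by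
  have := whiskerRight_comp_unit (F.mapId b).hom (unitObjIso h b).hom
  simp only [id_whiskerLeft, Category.assoc] at this
  simp [compUnitIso, ← this]

lemma compUnitIso_comp {a b c : B} (f : a ⟶ b) (g : b ⟶ c) :
    (compUnitIso (θ := θ) h (f ≫ g)).hom ≫ (F.mapComp f g).hom =
      F.map₂ (α_ _ _ _).hom ▷ θ _ ≫ (F.mapComp f (g ≫ unitObj h c)).hom ▷ θ _ ≫ (α_ _ _ _).hom ≫
        F.map f ◁ (compUnitIso h g).hom := by
  simp [compUnitIso, ← whiskerRight_comp_unit]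

lemma compUnitIso_unitCompMapIso {b b' : B} {c : C} (f : b ⟶ b') (g : F.obj b' ⟶ c) :
    (F.mapComp f (unitObj h b' ≫ map h g)).hom ▷ θ _ ≫ (α_ _ _ _).hom ≫
        F.map f ◁ (unitCompMapIso h g).hom =
      F.map₂ (α_ _ _ _).inv ▷ θ _ ≫ (compMapIso h (f ≫ unitObj h b') g).hom ≫
        (compUnitIso h f).hom ▷ g := by
  rw [reassoc_of% (compMapIso_comp h)]
  simp [compUnitIso, unitCompMapIso, compMapIso]

/-- The pseudonaturality constraint of the unit. -/
noncomputable def unitNaturality {b b' : B} (f : b ⟶ b') :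
    f ≫ unitObj (θ := θ) h b' ≅ unitObj h b ≫ map h (F.map f) :=
  liftIso h (compUnitIso h f ≪≫ (unitCompMapIso h (F.map f)).symm)

lemma unitNaturality_naturality {b b' : B} {f g : b ⟶ b'} (σ : f ⟶ g) :
    σ ▷ unitObj (θ := θ) h b' ≫ (unitNaturality h g).hom =
      (unitNaturality h f).hom ≫ unitObj h b ◁ map₂ h (F.map₂ σ) := by
  apply hom_ext h
  rw [← cancel_mono (unitCompMapIso h (F.map g)).hom]
  simp only [PrelaxFunctor.map₂_comp, comp_whiskerRight, Category.assoc,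
    unitCompMapIso_naturality]
  simp [unitNaturality, compUnitIso_naturality, -Pseudofunctor.map₂_whisker_right]

lemma unitNaturality_id (b : B) :
    (unitNaturality (θ := θ) h (𝟙 b)).hom ≫
        unitObj h b ◁ (map₂ h (F.mapId b).hom ≫ (mapId h (F.obj b)).hom) =
      𝟙 (𝟙 b) ▷ unitObj h b ≫ (λ_ _).hom ≫ (ρ_ _).inv := by
  rw [id_whiskerRight, Category.id_comp, ← cancel_mono (ρ_ _).hom]
  apply hom_ext h
  rw [← cancel_mono (unitObjIso h b).hom]
  simp only [PrelaxFunctor.map₂_comp, comp_whiskerRight, Category.assoc, whiskerLeft_comp,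
    unitCompMapIso_id, unitCompMapIso_naturality]
  rw [← Iso.symm_hom (ρ_ _), ← Iso.symm_inv (ρ_ (unitObj h b)),
    reassoc_of% (map₂_hom_inv_whiskerRight F)]
  simp [unitNaturality, compUnitIso_id, -Pseudofunctor.map₂_left_unitor]

lemma unitNaturality_comp {b b' b'' : B} (f : b ⟶ b') (g : b' ⟶ b'') :
    (unitNaturality (θ := θ) h (f ≫ g)).hom ≫
        unitObj h b ◁ (map₂ h (F.mapComp f g).hom ≫ (mapComp h (F.map f) (F.map g)).hom) =
      𝟙 (f ≫ g) ▷ unitObj h b'' ≫ (α_ _ _ _).hom ≫ f ◁ (unitNaturality h g).hom ≫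
        (α_ _ _ _).inv ≫ (unitNaturality h f).hom ▷ map h (F.map g) ≫ (α_ _ _ _).hom := by
  rw [id_whiskerRight, Category.id_comp, ← cancel_mono (α_ _ _ _).inv]
  apply hom_ext h
  rw [← cancel_mono (compMapIso h _ _).hom, ← cancel_mono ((unitCompMapIso h _).hom ▷ _)]
  simp only [PrelaxFunctor.map₂_comp, comp_whiskerRight, Category.assoc, whiskerLeft_comp,
    unitCompMapIso_comp, unitCompMapIso_naturality]
  have key : F.map₂ (unitNaturality (θ := θ) h f).hom ▷ θ _ ≫ (unitCompMapIso h (F.map f)).hom =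
    (compUnitIso h f).hom := by simp [unitNaturality]
  rw [reassoc_of% (map₂_hom_inv_whiskerRight F), reassoc_of% (compMapIso_naturality h),
    ← comp_whiskerRight, key, ← compUnitIso_unitCompMapIso]
  simp [unitNaturality, compUnitIso_comp, -Pseudofunctor.map₂_associator]

/-- The unit of the biadjunction. -/
noncomputable def unit :
    Pseudofunctor.StrongTrans (Pseudofunctor.id B) (F.comp (rightBiadjoint h)) where
  app b := unitObj h b
  naturality f := unitNaturality h f
  naturality_naturality σ := unitNaturality_naturality h σ
  naturality_id b := unitNaturality_id h b
  naturality_comp f g := unitNaturality_comp h f g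

/-- Biuniversal arrows define a biadjunction. -/
noncomputable def biadjunction : Biadjunction F (rightBiadjoint h) where
  unit := unit h
  counit := counit h
  isEquivalence b c := by
    let T : (F.obj b ⟶ c) ⥤ (b ⟶ G₀ c) := transpose (unit h) b c
    have := h b c
    have e : T ⋙ eval F (θ c) b ≅ 𝟭 _ :=
      NatIso.ofComponents (fun g => unitCompMapIso h g)
        (fun σ => unitCompMapIso_naturality h σ)
    have : (T ⋙ eval F (θ c) b).IsEquivalence := Functor.isEquivalence_of_iso e.symm
    exact (Functor.isEquivalence_of_comp_right T (eval F (θ c) b) : T.IsEquivalence)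
  left_triangle b := ⟨unitObjIso h b⟩
  right_triangle c := ⟨liftIso h (unitCompMapIso h (θ c) ≪≫ (λ_ _).symm ≪≫
    whiskerRightIso (F.mapId _).symm (θ c))⟩

end BiuniversalArrow

/-! ### Biadjoint biequivalences -/

section Equivalence

variable {B : Type u₁} [Bicategory.{w₁, v₁} B] {C : Type u₂} [Bicategory.{w₂, v₂} C]

lemma IsEquivalenceCell.of_isos {a b : B} {f : a ⟶ b} {g : b ⟶ a} (e : f ≫ g ≅ 𝟙 a)
    (e' : g ≫ f ≅ 𝟙 b) : IsEquivalenceCell f :=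
  ⟨.mkOfAdjointifyCounit e.symm e', rfl⟩

lemma IsEquivalenceCell.of_comp_iso_id {a b : B} {f : a ⟶ b} {g : b ⟶ a} (e : f ≫ g ≅ 𝟙 a)
    (hg : IsEquivalenceCell g) : IsEquivalenceCell f := by
  obtain ⟨E, rfl⟩ := hg
  have i : f ≅ E.inv := (ρ_ f).symm ≪≫ whiskerLeftIso f E.unit ≪≫ (α_ _ _ _).symm ≪≫
    whiskerRightIso e E.inv ≪≫ λ_ _
  exact .of_isos e (whiskerLeftIso _ i ≪≫ E.unit.symm)

lemma postcomp_isEquivalence (a : B) {b c : B} (E : b ≌ c) :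
    (postcomp a E.hom).IsEquivalence :=
  (CategoryTheory.Equivalence.mk (postcomp a E.hom) (postcomp a E.inv)
    (NatIso.ofComponents (fun u => ((ρ_ u).symm ≪≫ whiskerLeftIso u E.unit ≪≫ (α_ _ _ _).symm :
        u ≅ (u ≫ E.hom) ≫ E.inv))
      (fun {u v} σ => show σ ≫ (ρ_ v).inv ≫ v ◁ E.unit.hom ≫ (α_ _ _ _).inv =
        ((ρ_ u).inv ≫ u ◁ E.unit.hom ≫ (α_ _ _ _).inv) ≫ σ ▷ E.hom ▷ E.inv by
          have := whisker_exchange_assoc σ E.unit.hom (α_ _ _ _).inv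
          simp at this
          simp [this]))
    (NatIso.ofComponents (fun u => (α_ _ _ _ ≪≫ whiskerLeftIso u E.counit ≪≫ ρ_ u :
        (u ≫ E.inv) ≫ E.hom ≅ u))
      (fun {u v} σ => show σ ▷ E.inv ▷ E.hom ≫ (α_ _ _ _).hom ≫ v ◁ E.counit.hom ≫ (ρ_ v).hom =
        ((α_ _ _ _).hom ≫ u ◁ E.counit.hom ≫ (ρ_ u).hom) ≫ σ by
          simp [BiuniversalArrow.whiskerRight_comp_unit]))).isEquivalence_functor

lemma IsEquivalenceCell.of_map (F : B ⥤ᵖ C) (hF : ∀ a b, (F.mapFunctor a b).IsEquivalence)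
    {a b : B} {f : a ⟶ b} (hf : IsEquivalenceCell (F.map f)) : IsEquivalenceCell f := by
  obtain ⟨E, hE⟩ := hf
  have := hF
  let g : b ⟶ a := (F.mapFunctor b a).objPreimage E.inv
  let i : F.map g ≅ E.inv := (F.mapFunctor b a).objObjPreimageIso E.inv
  let j : F.map f ≅ E.hom := eqToIso hE.symm
  exact .of_isos (g := g)
    ((F.mapFunctor a a).preimageIso (F.mapComp f g ≪≫ whiskerRightIso j _ ≪≫
      whiskerLeftIso _ i ≪≫ E.unit.symm ≪≫ (F.mapId a).symm))
    ((F.mapFunctor b b).preimageIso (F.mapComp g f ≪≫ whiskerRightIso i _ ≪≫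
      whiskerLeftIso _ j ≪≫ E.counit ≪≫ (F.mapId b).symm))

/-- A pseudofunctor that is a local equivalence, and that is surjective on objects up to
equivalence, is part of a biadjoint biequivalence. -/
theorem exists_biadjunction_isBiequivalence (F : B ⥤ᵖ C)
    (hF : ∀ a b, (F.mapFunctor a b).IsEquivalence) (hF' : ∀ c, ∃ b, Nonempty (F.obj b ≌ c)) :
    ∃ (G : C ⥤ᵖ B) (b : Biadjunction F G), b.IsBiequivalence := by
  choose G₀ E using hF'
  let θ (c) : F.obj (G₀ c) ⟶ c := (E c).some.hom
  have h (b : B) (c : C) : (BiuniversalArrow.eval F (θ c) b).IsEquivalence := by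
    have := hF b (G₀ c)
    have := postcomp_isEquivalence (F.obj b) (E c).some
    exact inferInstanceAs (F.mapFunctor b (G₀ c) ⋙ postcomp (F.obj b) (θ c)).IsEquivalence
  exact ⟨_, BiuniversalArrow.biadjunction h,
    fun b => .of_map F hF (.of_comp_iso_id (BiuniversalArrow.unitObjIso h b) ⟨_, rfl⟩),
    fun c => ⟨_, rfl⟩⟩

end Equivalence

/-! ### The pseudofunctor of right adjoints -/

section RightAdjoints

variable {K : Type u} [Bicategory.{w, v} K] {R : Type u₁} [Bicategory.{w₁, v₁} R]

section

variable (T : R ⥤ᵖ K) {r : ∀ {X Y : R} (_ : X ⟶ Y), T.obj Y ⟶ T.obj X}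
  (adj : ∀ {X Y : R} (f : X ⟶ Y), T.map f ⊣ r f)

lemma conjugateEquiv_map₂_associator {W X Y Z : R} (f : W ⟶ X) (g : X ⟶ Y) (k : Y ⟶ Z) :
    Bicategory.conjugateEquiv (adj _) (adj _) (T.map₂ (α_ f g k).hom) =
      Bicategory.conjugateEquiv (adj _) ((adj _).comp (adj _)) (T.mapComp f (g ≫ k)).inv ≫
        Bicategory.conjugateEquiv (adj _) ((adj _).comp (adj _)) (T.mapComp g k).inv ▷ r f ≫
          (α_ _ _ _).hom ≫
            r k ◁ Bicategory.conjugateEquiv ((adj _).comp (adj _)) (adj _) (T.mapComp f g).hom ≫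
              Bicategory.conjugateEquiv ((adj _).comp (adj _)) (adj _)
                (T.mapComp (f ≫ g) k).hom := by
  rw [← Bicategory.conjugateEquiv_whiskerLeft (adj f),
    ← Bicategory.conjugateEquiv_whiskerRight _ _ (adj k),
    ← Bicategory.conjugateEquiv_associator_hom (adj f) (adj g) (adj k)]
  simp only [Bicategory.conjugateEquiv_comp]
  simp

lemma conjugateEquiv_map₂_rightUnitor {X Y : R} (f : X ⟶ Y) :
    Bicategory.conjugateEquiv (adj _) (adj _) (T.map₂ (ρ_ f).inv) =
      Bicategory.conjugateEquiv (adj _) ((adj _).comp (adj _)) (T.mapComp f (𝟙 Y)).inv ≫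
        Bicategory.conjugateEquiv (adj _) (Adjunction.id _) (T.mapId Y).inv ▷ r f ≫
          (λ_ _).hom := by
  have e : (λ_ (r f)).hom =
      Bicategory.conjugateEquiv ((adj f).comp (Adjunction.id _)) (adj f) (ρ_ _).inv := by
    have := Bicategory.conjugateEquiv_comp_id_right_apply (adj f) (adj f) (𝟙 _)
    simp only [Category.comp_id, Bicategory.conjugateEquiv_id, Category.id_comp] at this
    rw [← cancel_epi (λ_ (r f)).inv, Iso.inv_hom_id, ← this, Bicategory.conjugateEquiv_comp]
    simp
  rw [e, ← Bicategory.conjugateEquiv_whiskerLeft (adj f)]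
  simp only [Bicategory.conjugateEquiv_comp]
  congr 1
  rw [PrelaxFunctor.map₂_iso_inv]
  apply IsIso.inv_eq_of_hom_inv_id
  simp

lemma conjugateEquiv_map₂_leftUnitor {X Y : R} (f : X ⟶ Y) :
    Bicategory.conjugateEquiv (adj _) (adj _) (T.map₂ (λ_ f).inv) =
      Bicategory.conjugateEquiv (adj _) ((adj _).comp (adj _)) (T.mapComp (𝟙 X) f).inv ≫
        r f ◁ Bicategory.conjugateEquiv (adj _) (Adjunction.id _) (T.mapId X).inv ≫
          (ρ_ _).hom := by
  have e : (ρ_ (r f)).hom =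
      Bicategory.conjugateEquiv ((Adjunction.id _).comp (adj f)) (adj f) (λ_ _).inv := by
    have := Bicategory.conjugateEquiv_id_comp_right_apply (adj f) (adj f) (𝟙 _)
    simp only [Category.comp_id, Bicategory.conjugateEquiv_id, Category.id_comp] at this
    rw [← cancel_epi (ρ_ (r f)).inv, Iso.inv_hom_id, ← this, Bicategory.conjugateEquiv_comp]
    simp
  rw [e, ← Bicategory.conjugateEquiv_whiskerRight _ _ (adj f)]
  simp only [Bicategory.conjugateEquiv_comp]
  congr 1
  rw [PrelaxFunctor.map₂_iso_inv]
  apply IsIso.inv_eq_of_hom_inv_id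
  simp

end

/-- A pseudofunctor `T : R ⥤ᵖ K` whose 1-cells have right adjoints `r f` induces, by
taking conjugates, a pseudofunctor `R^coop ⥤ᵖ K`; it is corestricted here to a locally full
sub-bicategory of `K` containing its values. -/
def rightAdjointPseudofunctor {D : SubData K} (T : R ⥤ᵖ K)
    (r : ∀ {X Y : R} (_ : X ⟶ Y), T.obj Y ⟶ T.obj X) (adj : ∀ {X Y : R} (f : X ⟶ Y), T.map f ⊣ r f)
    (hob : ∀ X, D.ob (T.obj X)) (hmor : ∀ {X Y : R} (f : X ⟶ Y), D.mor (r f)) :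
    Coop R ⥤ᵖ SubBicat D where
  obj X := ⟨T.obj X.obj, hob _⟩
  map f := ⟨r f.rev, hmor _⟩
  map₂ {X Y f g} σ := ⟨Bicategory.conjugateEquiv (adj f.rev) (adj g.rev) (T.map₂ σ.rev)⟩
  map₂_id f := by ext; simp
  map₂_comp σ τ := by ext; simp
  mapId X := SubBicat.isoMk (conjugateIsoEquiv (adj (𝟙 X.obj)) (Adjunction.id _) (T.mapId _).symm)
  mapComp f g := SubBicat.isoMk (conjugateIsoEquiv (adj (g.rev ≫ f.rev))
    ((adj g.rev).comp (adj f.rev)) (T.mapComp g.rev f.rev).symm)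
  map₂_whisker_left f g g' σ := by
    ext
    change Bicategory.conjugateEquiv _ _ (T.map₂ (σ.rev ▷ f.rev)) =
      Bicategory.conjugateEquiv _ _ (T.mapComp _ _).inv ≫
        r f.rev ◁ Bicategory.conjugateEquiv _ _ (T.map₂ σ.rev) ≫
          Bicategory.conjugateEquiv _ _ (T.mapComp _ _).hom
    rw [← Bicategory.conjugateEquiv_whiskerRight _ _ (adj f.rev), Bicategory.conjugateEquiv_comp,
      Bicategory.conjugateEquiv_comp]
    simp
  map₂_whisker_right {X Y Z f f'} σ g := by
    ext
    change Bicategory.conjugateEquiv _ _ (T.map₂ (g.rev ◁ σ.rev)) =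
      Bicategory.conjugateEquiv _ _ (T.mapComp _ _).inv ≫
        Bicategory.conjugateEquiv _ _ (T.map₂ σ.rev) ▷ r g.rev ≫
          Bicategory.conjugateEquiv _ _ (T.mapComp _ _).hom
    rw [← Bicategory.conjugateEquiv_whiskerLeft (adj g.rev), Bicategory.conjugateEquiv_comp,
      Bicategory.conjugateEquiv_comp]
    simp
  map₂_associator f g k := by
    ext
    exact conjugateEquiv_map₂_associator T adj k.rev g.rev f.rev
  map₂_left_unitor f := by
    ext
    exact conjugateEquiv_map₂_rightUnitor T adj f.rev
  map₂_right_unitor f := by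
    ext
    exact conjugateEquiv_map₂_leftUnitor T adj f.rev

lemma rightAdjointPseudofunctor_isEquivalence {D : SubData K} (T : R ⥤ᵖ K)
    (r : ∀ {X Y : R} (_ : X ⟶ Y), T.obj Y ⟶ T.obj X) (adj : ∀ {X Y : R} (f : X ⟶ Y), T.map f ⊣ r f)
    (hob : ∀ X, D.ob (T.obj X)) (hmor : ∀ {X Y : R} (f : X ⟶ Y), D.mor (r f))
    (hT : ∀ {X Y : R} (f g : X ⟶ Y), Function.Bijective (T.map₂ : (f ⟶ g) → _))
    (hsurj : ∀ {X Y : R} (s : T.obj Y ⟶ T.obj X), D.mor s → ∃ f : X ⟶ Y, Nonempty (r f ≅ s))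
    (X Y : Coop R) :
    ((rightAdjointPseudofunctor T r adj hob hmor).mapFunctor X Y).IsEquivalence where
  faithful := ⟨fun {f g} σ τ h => by
    ext
    exact (hT _ _).1 ((Bicategory.conjugateEquiv (adj f.rev) (adj g.rev)).injective
      (congrArg SubBicat.Hom₂.hom h))⟩
  full := ⟨fun {f g} σ => by
    obtain ⟨τ, hτ⟩ := (hT _ _).2 ((Bicategory.conjugateEquiv (adj f.rev) (adj g.rev)).symm σ.hom)
    refine ⟨⟨τ⟩, SubBicat.hom₂_ext ?_⟩
    exact (congrArg _ hτ).trans (Equiv.apply_symm_apply _ _)⟩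
  essSurj := ⟨fun s => by
    obtain ⟨f, ⟨e⟩⟩ := hsurj s.hom s.mem
    exact ⟨⟨f⟩, ⟨SubBicat.isoMk e⟩⟩⟩

end RightAdjoints

/-! ### Left extensions -/

section Extensions

variable {K : Type u} [Bicategory.{w, v} K] {W X Y Z : K}

/-- The 1-cell `h` is the left extension of its own restriction along `f`, via the identity
2-cell: whiskering with `f` is a bijection from 2-cells `h ⟶ k` to 2-cells `f ≫ h ⟶ f ≫ k`. -/
def ExtendsAlong (f : X ⟶ Y) (h : Y ⟶ Z) : Prop :=
  ∀ k : Y ⟶ Z, Function.Bijective (fun τ : h ⟶ k => f ◁ τ)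

lemma isLeftExtension_iff_extendsAlong {f : X ⟶ Y} {g : X ⟶ Z} {h : Y ⟶ Z} (η : g ≅ f ≫ h) :
    IsLeftExtension η.hom ↔ ExtendsAlong f h := by
  rw [isLeftExtension_iff]
  constructor
  · intro H k
    rw [Function.bijective_iff_existsUnique]
    intro σ
    obtain ⟨τ, h₁, h₂⟩ := H k (η.hom ≫ σ)
    exact ⟨τ, (cancel_epi η.hom).1 h₁, fun τ' h' => h₂ τ' (congrArg (η.hom ≫ ·) h')⟩
  · intro H k σ
    obtain ⟨τ, h₁, h₂⟩ := Function.bijective_iff_existsUnique _ |>.1 (H k) (η.inv ≫ σ)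
    exact ⟨τ, (Iso.eq_inv_comp η).1 h₁, fun τ' h' => h₂ τ' ((Iso.eq_inv_comp η).2 h')⟩

lemma ExtendsAlong.of_iso {f : X ⟶ Y} {h h' : Y ⟶ Z} (H : ExtendsAlong f h) (e : h ≅ h') :
    ExtendsAlong f h' := by
  intro k
  have : (fun τ : h' ⟶ k => f ◁ τ) = (fun σ => (whiskerLeftIso f e).inv ≫ σ) ∘
      (fun τ : h ⟶ k => f ◁ τ) ∘ (fun τ => e.hom ≫ τ) := by
    ext τ; simp
  rw [this]
  exact (Iso.homFromEquiv (whiskerLeftIso f e)).bijective.comp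
    ((H k).comp (Iso.homFromEquiv e.symm).bijective)

lemma ExtendsAlong.of_iso_left {f f' : X ⟶ Y} {h : Y ⟶ Z} (H : ExtendsAlong f h) (e : f ≅ f') :
    ExtendsAlong f' h := by
  intro k
  have : (fun τ : h ⟶ k => f' ◁ τ) = (fun σ => (whiskerRightIso e h).inv ≫ σ) ∘
      (fun σ => σ ≫ (whiskerRightIso e k).hom) ∘ (fun τ : h ⟶ k => f ◁ τ) := by
    ext τ
    simp [whisker_exchange]
  rw [this]
  exact (Iso.homFromEquiv (whiskerRightIso e h)).bijective.comp
    ((Iso.homToEquiv (whiskerRightIso e k)).bijective.comp (H k))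

/-- Two extensions of isomorphic 1-cells are isomorphic. -/
lemma ExtendsAlong.exists_iso {f : X ⟶ Y} {h h' : Y ⟶ Z} (H : ExtendsAlong f h)
    (H' : ExtendsAlong f h') (e : f ≫ h ≅ f ≫ h') : ∃ i : h ≅ h', f ◁ i.hom = e.hom := by
  obtain ⟨a, ha⟩ := (H h').2 e.hom
  obtain ⟨b, hb⟩ := (H' h).2 e.inv
  dsimp at ha hb
  exact ⟨⟨a, b, (H h).1 (by simp [ha, hb]), (H' h').1 (by simp [ha, hb])⟩, ha⟩

lemma homEquiv₂_whisker {L : Z ⟶ W} {R : W ⟶ Z} (adj : L ⊣ R) {f : X ⟶ Y} {g : X ⟶ Z} {h : Y ⟶ Z}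
    (η : g ⟶ f ≫ h) {k : Y ⟶ W} (τ : h ≫ L ⟶ k) :
    adj.homEquiv₂ (η ▷ L ≫ (α_ f h L).hom ≫ f ◁ τ) ≫ (α_ f k R).hom =
      η ≫ f ◁ adj.homEquiv₂ τ := by
  rw [Bicategory.Adjunction.homEquiv₂_apply, Bicategory.Adjunction.homEquiv₂_apply]
  calc
    _ = 𝟙 _ ⊗≫ (g ◁ adj.unit ≫ η ▷ (L ≫ R)) ⊗≫ f ◁ τ ▷ R ⊗≫ 𝟙 _ := by bicategory
    _ = _ := by rw [whisker_exchange]; bicategory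

/-- Left adjoints preserve left extensions. -/
lemma IsLeftExtension.preserves_of_adjunction {f : X ⟶ Y} {g : X ⟶ Z} {h : Y ⟶ Z} {η : g ⟶ f ≫ h}
    (H : IsLeftExtension η) {L : Z ⟶ W} {R : W ⟶ Z} (adj : L ⊣ R) : PreservesExtension η L := by
  rw [isLeftExtension_iff] at H
  refine (isLeftExtension_iff _).2 fun k σ => ?_
  obtain ⟨τ, h₁, h₂⟩ := H (k ≫ R) (adj.homEquiv₂ σ ≫ (α_ f k R).hom)
  have key (τ' : h ≫ L ⟶ k) : (η ▷ L ≫ (α_ f h L).hom) ≫ f ◁ τ' = σ ↔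
      η ≫ f ◁ adj.homEquiv₂ τ' = adj.homEquiv₂ σ ≫ (α_ f k R).hom := by
    rw [← homEquiv₂_whisker, cancel_mono, adj.homEquiv₂.injective.eq_iff, Category.assoc]
  refine ⟨adj.homEquiv₂.symm τ, (key _).2 (by simpa using h₁), fun τ' h' => ?_⟩
  rw [Equiv.eq_symm_apply]
  exact h₂ _ ((key _).1 h')

lemma ExtendsAlong.comp_left_adjoint {f : X ⟶ Y} {h : Y ⟶ Z} (H : ExtendsAlong f h) {L : Z ⟶ W}
    {R : W ⟶ Z} (adj : L ⊣ R) : ExtendsAlong f (h ≫ L) :=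
  (isLeftExtension_iff_extendsAlong (whiskerRightIso (Iso.refl (f ≫ h)) L ≪≫ α_ f h L)).1
    (((isLeftExtension_iff_extendsAlong (Iso.refl _)).2 H).preserves_of_adjunction adj)

lemma preservesExtension_iff {f : X ⟶ Y} {g : X ⟶ Z} {h : Y ⟶ Z} (η : g ≅ f ≫ h) (k : Z ⟶ W) :
    PreservesExtension η.hom k ↔ ExtendsAlong f (h ≫ k) :=
  isLeftExtension_iff_extendsAlong (whiskerRightIso η k ≪≫ α_ f h k)

/-- Left extensions of a 1-cell are unique up to isomorphism. -/
lemma IsLeftExtension.exists_iso {f : X ⟶ Y} {g : X ⟶ Z} {h h' : Y ⟶ Z} {η : g ⟶ f ≫ h}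
    {η' : g ⟶ f ≫ h'} (H : IsLeftExtension η) (H' : IsLeftExtension η') :
    ∃ i : h ≅ h', η ≫ f ◁ i.hom = η' := by
  rw [isLeftExtension_iff] at H H'
  obtain ⟨a, ha, -⟩ := H h' η'
  obtain ⟨b, hb, -⟩ := H' h η
  exact ⟨⟨a, b, (H h η).unique (by simp [reassoc_of% ha, hb]) (by simp),
    (H' h' η').unique (by simp [reassoc_of% hb, ha]) (by simp)⟩, ha⟩

lemma IsLeftExtension.nonempty_iso {f : X ⟶ Y} {g g' : X ⟶ Z} {h h' : Y ⟶ Z} {η : g ⟶ f ≫ h}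
    {η' : g' ⟶ f ≫ h'} (H : IsLeftExtension η) (H' : IsLeftExtension η') (e : g ≅ g') :
    Nonempty (h ≅ h') := by
  have : IsLeftExtension (e.hom ≫ η') := by
    rw [isLeftExtension_iff] at H' ⊢
    intro k σ
    obtain ⟨τ, h₁, h₂⟩ := H' k (e.inv ≫ σ)
    exact ⟨τ, by simp [h₁], fun τ' h' => h₂ τ' (by simp [← h'])⟩
  exact ⟨(H.exists_iso this).choose⟩

/-- Left extensions compose along the 1-cells along which one extends. -/
lemma IsLeftExtension.comp {f : X ⟶ Y} {g : X ⟶ Z} {h : Y ⟶ Z} {η : g ⟶ f ≫ h}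
    (H : IsLeftExtension η) {f' : Y ⟶ W} {h' : W ⟶ Z} (H' : ExtendsAlong f' h')
    (e : h ≅ f' ≫ h') : IsLeftExtension (η ≫ f ◁ e.hom ≫ (α_ f f' h').inv) := by
  rw [isLeftExtension_iff] at H ⊢
  intro k σ
  obtain ⟨τ, h₁, h₂⟩ := H (f' ≫ k) (σ ≫ (α_ f f' k).hom)
  obtain ⟨τ', rfl⟩ := (H' k).2 (e.inv ≫ τ) |>.imp fun _ h => (Iso.eq_inv_comp e).1 h
  refine ⟨τ', ?_, fun τ'' h'' => (H' k).1 ?_⟩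
  · refine (cancel_mono (α_ f f' k).hom).1 ?_
    rw [← h₁]
    simp
  · rw [← cancel_epi e.hom]
    exact h₂ _ (by simp [← h''])

/-- A bijection between 2-cells given by whiskering is invariant under isomorphism. -/
lemma whiskerLeft_bijective_of_iso {f : X ⟶ Y} {h k h' k' : Y ⟶ Z} (e : h ≅ h') (i : k ≅ k')
    (H : Function.Bijective (fun τ : h ⟶ k => f ◁ τ)) :
    Function.Bijective (fun τ : h' ⟶ k' => f ◁ τ) := by
  have : (fun τ : h' ⟶ k' => f ◁ τ) =
      (fun σ => (whiskerLeftIso f e).symm.hom ≫ σ ≫ (whiskerLeftIso f i).hom) ∘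
      (fun τ : h ⟶ k => f ◁ τ) ∘ (fun τ => e.hom ≫ τ ≫ i.symm.hom) := by
    ext τ; simp
  rw [this]
  exact (Iso.homCongr (whiskerLeftIso f e) (whiskerLeftIso f i)).bijective.comp
    (H.comp (Iso.homCongr e.symm i.symm).bijective)

lemma whiskerLeft_comp_eq (f : X ⟶ Y) (g : Y ⟶ Z) (h k : Z ⟶ W) :
    (fun σ : h ⟶ k => (f ≫ g) ◁ σ) = (fun σ => (α_ f g h).hom ≫ σ ≫ (α_ f g k).symm.hom) ∘
      (fun σ : g ≫ h ⟶ g ≫ k => f ◁ σ) ∘ (fun σ => g ◁ σ) := by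
  ext σ; simp

lemma whiskerLeft_bijective_of_comp {f : X ⟶ Y} {g : Y ⟶ Z} {h k : Z ⟶ W}
    (H : Function.Bijective (fun σ : h ⟶ k => (f ≫ g) ◁ σ))
    (H' : Function.Bijective (fun σ : h ⟶ k => g ◁ σ)) :
    Function.Bijective (fun σ : g ≫ h ⟶ g ≫ k => f ◁ σ) := by
  rw [whiskerLeft_comp_eq] at H
  exact (Function.Bijective.of_comp_iff _ H').1 ((Function.Bijective.of_comp_iff'
    (Iso.homCongr (α_ f g h).symm (α_ f g k).symm).bijective _).1 H)

lemma extendsAlong_id (h : X ⟶ Y) : ExtendsAlong (𝟙 X) h := by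
  intro k
  have : (fun τ : h ⟶ k => 𝟙 X ◁ τ) = fun τ => (λ_ h).hom ≫ τ ≫ (λ_ k).symm.hom := by
    ext τ; simp
  rw [this]
  exact (Iso.homCongr (λ_ h).symm (λ_ k).symm).bijective

lemma extendsAlong_equivalence (e : X ≌ Y) (h : Y ⟶ Z) : ExtendsAlong e.hom h := by
  have inj {P Q : K} (a : P ⟶ Q) (b : Q ⟶ P) (i : 𝟙 Q ≅ b ≫ a) (h k : Q ⟶ Z) :
      Function.Injective (fun τ : h ⟶ k => a ◁ τ) := by
    have H := ((extendsAlong_id h).of_iso_left i) k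
    rw [whiskerLeft_comp_eq] at H
    exact H.1.of_comp.of_comp
  intro k
  refine ⟨inj _ _ e.counit.symm _ _, fun σ => ?_⟩
  obtain ⟨τ, hτ⟩ := ((extendsAlong_id h).of_iso_left e.counit.symm k).2
    ((α_ _ _ _).hom ≫ e.inv ◁ σ ≫ (α_ _ _ _).inv)
  refine ⟨τ, inj _ _ e.unit _ _ ?_⟩
  simpa using hτ

end Extensions

/-! ### Fully faithful 1-cells -/

section FullyFaithful

variable {K : Type u} [Bicategory.{w, v} K] {X Y Z : K}

lemma isRepFullyFaithful_iff {f : X ⟶ Y} :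
    IsRepFullyFaithful f ↔ ∀ {T : K} (a b : T ⟶ X), Function.Bijective (fun σ : a ⟶ b => σ ▷ f) :=
  ⟨fun H T _ _ => ⟨fun _ _ h => (H T).2.map_injective h, (H T).1.map_surjective⟩,
    fun H _ => ⟨⟨(H _ _).2⟩, ⟨fun h => (H _ _).1 h⟩⟩⟩

lemma IsRepFullyFaithful.of_iso {f g : X ⟶ Y} (H : IsRepFullyFaithful f) (e : f ≅ g) :
    IsRepFullyFaithful g := by
  rw [isRepFullyFaithful_iff] at *
  intro T a b
  have : (fun σ : a ⟶ b => σ ▷ g) = (fun σ => (whiskerLeftIso a e).inv ≫ σ) ∘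
      (fun σ => σ ≫ (whiskerLeftIso b e).hom) ∘ (fun σ : a ⟶ b => σ ▷ f) := by
    ext σ
    simp [← whisker_exchange]
  rw [this]
  exact (Iso.homFromEquiv (whiskerLeftIso a e)).bijective.comp
    ((Iso.homToEquiv (whiskerLeftIso b e)).bijective.comp (H a b))

lemma whiskerRight_comp_eq {T : K} (a b : T ⟶ X) (f : X ⟶ Y) (g : Y ⟶ Z) :
    (fun σ : a ⟶ b => σ ▷ (f ≫ g)) = (fun σ => (α_ a f g).symm.hom ≫ σ ≫ (α_ b f g).hom) ∘
      (fun σ : a ≫ f ⟶ b ≫ f => σ ▷ g) ∘ (fun σ => σ ▷ f) := by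
  ext σ; simp

lemma IsRepFullyFaithful.comp {f : X ⟶ Y} {g : Y ⟶ Z} (hf : IsRepFullyFaithful f)
    (hg : IsRepFullyFaithful g) : IsRepFullyFaithful (f ≫ g) := by
  rw [isRepFullyFaithful_iff] at *
  intro T a b
  rw [whiskerRight_comp_eq]
  exact (Iso.homCongr (α_ a f g) (α_ b f g)).bijective.comp ((hg _ _).comp (hf _ _))

lemma IsRepFullyFaithful.of_comp {f : X ⟶ Y} {g : Y ⟶ Z} (hfg : IsRepFullyFaithful (f ≫ g))
    (hg : IsRepFullyFaithful g) : IsRepFullyFaithful f := by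
  rw [isRepFullyFaithful_iff] at *
  intro T a b
  have := hfg a b
  rw [whiskerRight_comp_eq] at this
  exact (Function.Bijective.of_comp_iff' (hg _ _) _).1
    ((Function.Bijective.of_comp_iff' (Iso.homCongr (α_ a f g) (α_ b f g)).bijective _).1 this)

lemma IsRepFullyFaithful.of_equivalence (e : X ≌ Y) : IsRepFullyFaithful e.hom := fun T =>
  have := postcomp_isEquivalence T e
  ⟨inferInstance, inferInstance⟩

end FullyFaithful

/-! ### Adjunctions -/

section Adjunctions

variable {K : Type u} [Bicategory.{w, v} K] {X Y Z : K}

/-- The adjunction underlying an equivalence. -/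
def equivalenceAdjunction (e : X ≌ Y) : e.hom ⊣ e.inv where
  unit := e.unit.hom
  counit := e.counit.hom
  left_triangle := e.left_triangle_hom
  right_triangle := e.right_triangle_hom

/-- The adjunction underlying the inverse of an equivalence. -/
@[simps]
def equivalenceSymmAdjunction (e : X ≌ Y) : e.inv ⊣ e.hom where
  unit := e.counit.inv
  counit := e.unit.inv
  left_triangle := by
    rw [← Bicategory.rightZigzagIso_inv, e.right_triangle]
    simp
  right_triangle := by
    rw [← Bicategory.leftZigzagIso_inv, e.left_triangle]
    simp

/-- Transport of an adjunction along an isomorphism of left adjoints. -/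
@[simps]
def adjunctionOfIsoLeft {l l' : X ⟶ Y} {r : Y ⟶ X} (adj : l ⊣ r) (e : l ≅ l') : l' ⊣ r where
  unit := adj.unit ≫ e.hom ▷ r
  counit := r ◁ e.inv ≫ adj.counit
  left_triangle := by
    calc
      _ = adj.unit ▷ l' ⊗≫ (e.hom ▷ (r ≫ l') ≫ l' ◁ (r ◁ e.inv ≫ adj.counit)) := by
        bicategory
      _ = (adj.unit ▷ l' ≫ (l ≫ r) ◁ e.inv) ⊗≫ l ◁ adj.counit ⊗≫ e.hom ⊗≫ 𝟙 _ := by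
        rw [← whisker_exchange]; bicategory
      _ = 𝟙 _ ⊗≫ e.inv ⊗≫ leftZigzag adj.unit adj.counit ⊗≫ e.hom ⊗≫ 𝟙 _ := by
        rw [← whisker_exchange]; bicategory
      _ = _ := by
        rw [adj.left_triangle]
        simp [bicategoricalComp]
  right_triangle := by
    calc
      _ = r ◁ adj.unit ⊗≫ r ◁ (e.hom ≫ e.inv) ▷ r ⊗≫ adj.counit ▷ r := by bicategory
      _ = rightZigzag adj.unit adj.counit := by
        rw [e.hom_inv_id]; bicategory
      _ = _ := adj.right_triangle

/-- Transport of an adjunction along an isomorphism of right adjoints. -/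
def adjunctionOfIsoRight {l : X ⟶ Y} {r r' : Y ⟶ X} (adj : l ⊣ r) (e : r ≅ r') : l ⊣ r' where
  unit := adj.unit ≫ l ◁ e.hom
  counit := e.inv ▷ l ≫ adj.counit
  left_triangle := by
    calc
      _ = adj.unit ▷ l ⊗≫ l ◁ (e.hom ≫ e.inv) ▷ l ⊗≫ l ◁ adj.counit := by bicategory
      _ = leftZigzag adj.unit adj.counit := by
        rw [e.hom_inv_id]; bicategory
      _ = _ := adj.left_triangle
  right_triangle := by
    calc
      _ = r' ◁ adj.unit ⊗≫ ((r' ≫ l) ◁ e.hom ≫ (e.inv ▷ l ≫ adj.counit) ▷ r') := by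
        bicategory
      _ = (r' ◁ adj.unit ≫ e.inv ▷ (l ≫ r)) ⊗≫ adj.counit ▷ r ⊗≫ e.hom ⊗≫ 𝟙 _ := by
        rw [whisker_exchange]; bicategory
      _ = 𝟙 _ ⊗≫ e.inv ⊗≫ rightZigzag adj.unit adj.counit ⊗≫ e.hom ⊗≫ 𝟙 _ := by
        rw [whisker_exchange]; bicategory
      _ = _ := by
        rw [adj.right_triangle]
        simp [bicategoricalComp]

/-- Taking conjugates is compatible with transporting adjunctions along isomorphisms of left
adjoints. -/
lemma conjugateEquiv_adjunctionOfIsoLeft {l l' m m' : X ⟶ Y} {r s : Y ⟶ X} (adj : l ⊣ r)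
    (e : l ≅ m) (adj' : l' ⊣ s) (e' : l' ≅ m')
    (τ : l' ⟶ l) :
    Bicategory.conjugateEquiv (adjunctionOfIsoLeft adj e) (adjunctionOfIsoLeft adj' e')
        (e'.inv ≫ τ ≫ e.hom) =
      Bicategory.conjugateEquiv adj adj' τ := by
  have h₁ : Bicategory.conjugateEquiv (adjunctionOfIsoLeft adj e) adj e.hom = 𝟙 r := by
    rw [Bicategory.conjugateEquiv_apply', ← Bicategory.conjugateEquiv_id adj,
      Bicategory.conjugateEquiv_apply', adjunctionOfIsoLeft_counit]
    calc
      _ = 𝟙 _ ⊗≫ r ◁ adj.unit ⊗≫ r ◁ (e.hom ≫ e.inv) ▷ r ⊗≫ adj.counit ▷ r ⊗≫ 𝟙 _ := by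
        bicategory
      _ = _ := by
        rw [e.hom_inv_id]; bicategory
  have h₂ : Bicategory.conjugateEquiv adj' (adjunctionOfIsoLeft adj' e') e'.inv = 𝟙 s := by
    rw [Bicategory.conjugateEquiv_apply', ← Bicategory.conjugateEquiv_id adj',
      Bicategory.conjugateEquiv_apply', adjunctionOfIsoLeft_unit]
    calc
      _ = 𝟙 _ ⊗≫ s ◁ adj'.unit ⊗≫ s ◁ (e'.hom ≫ e'.inv) ▷ s ⊗≫ adj'.counit ▷ s ⊗≫ 𝟙 _ := by
        bicategory
      _ = _ := by
        rw [e'.hom_inv_id]; bicategory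
  rw [← Bicategory.conjugateEquiv_comp (adjunctionOfIsoLeft adj e) adj',
    ← Bicategory.conjugateEquiv_comp (adjunctionOfIsoLeft adj e) adj, h₁, h₂]
  simp

/-- Right adjoints of isomorphic 1-cells are isomorphic. -/
def rightAdjointIso {l l' : X ⟶ Y} {r r' : Y ⟶ X} (adj : l ⊣ r) (adj' : l' ⊣ r') (e : l ≅ l') :
    r ≅ r' :=
  Bicategory.conjugateIsoEquiv adj adj' e.symm

/-- The counit of an adjunction with fully faithful right adjoint is invertible. -/
lemma isIso_counit_of_fullyFaithful {l : X ⟶ Y} {r : Y ⟶ X} (adj : l ⊣ r)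
    (hr : IsRepFullyFaithful r) : IsIso adj.counit := by
  rw [isRepFullyFaithful_iff] at hr
  obtain ⟨δ, hδ⟩ := (hr (𝟙 Y) (r ≫ l)).2
    ((λ_ r).hom ≫ (ρ_ r).inv ≫ r ◁ adj.unit ≫ (α_ r l r).inv)
  dsimp at hδ
  have ht : r ◁ adj.unit ≫ (α_ r l r).inv ≫ adj.counit ▷ r = (ρ_ r).hom ≫ (λ_ r).inv := by
    simpa [rightZigzag, bicategoricalComp] using adj.right_triangle
  refine ⟨δ, ?_, ?_⟩
  · apply adj.homEquiv₂.injective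
    simp [Bicategory.Adjunction.homEquiv₂_apply, hδ, reassoc_of% ht]
  · apply (hr _ _).1
    simp [hδ, ht]

/-- If `l ⊣ j` is a reflection and `l ≫ h` has a right adjoint `r`, then `r ≫ l` is right adjoint
to `h`. -/
lemma nonempty_adjunction_of_reflection {l : X ⟶ Y} {j : Y ⟶ X} (adj : l ⊣ j) [IsIso adj.counit]
    {h : Y ⟶ Z} {r : Z ⟶ X} (adj' : l ≫ h ⊣ r) : Nonempty (h ⊣ r ≫ l) := by
  have e : l ◁ inv adj.counit = 𝟙 _ ⊗≫ adj.unit ▷ l ⊗≫ 𝟙 _ := by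
    rw [← cancel_mono (l ◁ adj.counit), ← whiskerLeft_comp, IsIso.inv_hom_id]
    calc
      _ = (ρ_ l).hom ≫ (λ_ l).inv ≫ leftZigzag adj.unit adj.counit := by
        rw [adj.left_triangle]; simp
      _ = _ := by bicategory
  refine ⟨⟨inv adj.counit ⊗≫ j ◁ adj'.unit ▷ l ⊗≫ adj.counit ▷ (h ≫ r ≫ l) ⊗≫ 𝟙 _,
    𝟙 _ ⊗≫ adj'.counit, ?_, ?_⟩⟩
  · calc
      _ = inv adj.counit ▷ h ⊗≫ j ◁ adj'.unit ▷ l ▷ h ⊗≫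
          (adj.counit ▷ (h ≫ r ≫ l ≫ h) ≫ 𝟙 Y ◁ h ◁ adj'.counit) ⊗≫ 𝟙 _ := by bicategory
      _ = inv adj.counit ▷ h ⊗≫ j ◁ leftZigzag adj'.unit adj'.counit ⊗≫ adj.counit ▷ h ⊗≫ 𝟙 _ := by
        rw [← whisker_exchange]; bicategory
      _ = 𝟙 _ ⊗≫ (inv adj.counit ≫ adj.counit) ▷ h ⊗≫ 𝟙 _ := by
        rw [adj'.left_triangle]; bicategory
      _ = _ := by
        rw [IsIso.inv_hom_id]; bicategory
  · calc
      _ = 𝟙 _ ⊗≫ r ◁ (l ◁ inv adj.counit) ⊗≫ r ◁ l ◁ j ◁ adj'.unit ▷ l ⊗≫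
          r ◁ l ◁ adj.counit ▷ (h ≫ r ≫ l) ⊗≫ adj'.counit ▷ (r ≫ l) ⊗≫ 𝟙 _ := by bicategory
      _ = 𝟙 _ ⊗≫ r ◁ (adj.unit ▷ 𝟙 X ≫ (l ≫ j) ◁ adj'.unit) ▷ l ⊗≫
          r ◁ l ◁ adj.counit ▷ (h ≫ r ≫ l) ⊗≫ adj'.counit ▷ (r ≫ l) ⊗≫ 𝟙 _ := by
        rw [e]; bicategory
      _ = 𝟙 _ ⊗≫ r ◁ adj'.unit ▷ l ⊗≫ r ◁ leftZigzag adj.unit adj.counit ▷ (h ≫ r ≫ l) ⊗≫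
          adj'.counit ▷ (r ≫ l) ⊗≫ 𝟙 _ := by
        rw [← whisker_exchange]; bicategory
      _ = 𝟙 _ ⊗≫ rightZigzag adj'.unit adj'.counit ▷ l ⊗≫ 𝟙 _ := by
        rw [adj.left_triangle]; bicategory
      _ = _ := by
        rw [adj'.right_triangle]; bicategory

lemma map₂_associator_inv {C : Type u₁} [Bicategory.{w₁, v₁} C] (T : K ⥤ᵖ C) {W : K} (f : W ⟶ X)
    (g : X ⟶ Y) (h : Y ⟶ Z) :
    T.map₂ (α_ f g h).inv = (T.mapComp f (g ≫ h)).hom ≫ T.map f ◁ (T.mapComp g h).hom ≫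
      (α_ _ _ _).inv ≫ (T.mapComp f g).inv ▷ T.map h ≫ (T.mapComp (f ≫ g) h).inv := by
  rw [PrelaxFunctor.map₂_iso_inv]
  apply IsIso.inv_eq_of_hom_inv_id
  simp

/-- Pseudofunctors that are locally fully faithful reflect adjunctions. -/
lemma nonempty_adjunction_of_map {C : Type u₁} [Bicategory.{w₁, v₁} C] (T : K ⥤ᵖ C)
    (hT : ∀ {X Y : K} (f g : X ⟶ Y), Function.Bijective (T.map₂ : (f ⟶ g) → _)) {l : X ⟶ Y}
    {r : Y ⟶ X} (adj : T.map l ⊣ T.map r) : Nonempty (l ⊣ r) := by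
  obtain ⟨u, hu⟩ := (hT _ _).2 ((T.mapId X).hom ≫ adj.unit ≫ (T.mapComp l r).inv)
  obtain ⟨c, hc⟩ := (hT _ _).2 ((T.mapComp r l).hom ≫ adj.counit ≫ (T.mapId Y).inv)
  have h₁ : adj.unit ▷ T.map l ≫ (α_ _ _ _).hom ≫ T.map l ◁ adj.counit =
      (λ_ (T.map l)).hom ≫ (ρ_ (T.map l)).inv := by
    simpa [leftZigzag, bicategoricalComp] using adj.left_triangle
  have h₂ : T.map r ◁ adj.unit ≫ (α_ _ _ _).inv ≫ adj.counit ▷ T.map r =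
      (ρ_ (T.map r)).hom ≫ (λ_ (T.map r)).inv := by
    simpa [rightZigzag, bicategoricalComp] using adj.right_triangle
  refine ⟨⟨u, c, (hT _ _).1 ?_, (hT _ _).1 ?_⟩⟩
  · simp [leftZigzag, bicategoricalComp, hu, hc, reassoc_of% h₁, T.mapComp_id_right_inv]
  · simp [rightZigzag, bicategoricalComp, hu, hc, map₂_associator_inv, reassoc_of% h₂,
      T.mapComp_id_left_inv]

end Adjunctions

/-! ### Locally full sub-bicategories -/

/-- The small objects, with all 1-cells between them. -/
def smallData {K : Type u} [Bicategory.{w, v} K] (small : K → Prop) : SubData K where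
  ob := small
  mor _ := True
  id_mem _ := trivial
  comp_mem _ _ _ _ := trivial

/-- The inclusion of a locally full sub-bicategory into a larger one. -/
def SubBicat.inclusion {K : Type u} [Bicategory.{w, v} K] {D D' : SubData K}
    (hob : ∀ X, D.ob X → D'.ob X) (hmor : ∀ {X Y : K} (f : X ⟶ Y), D.mor f → D'.mor f) :
    SubBicat D ⥤ᵖ SubBicat D' where
  obj X := ⟨X.obj, hob _ X.property⟩
  map f := ⟨f.hom, hmor _ f.mem⟩
  map₂ σ := ⟨σ.hom⟩
  mapId X := SubBicat.isoMk (Iso.refl _)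
  mapComp f g := SubBicat.isoMk (Iso.refl _)
  map₂_whisker_left f g h σ := by
    ext
    exact ((Category.id_comp _).trans (Category.comp_id _)).symm
  map₂_whisker_right σ f := by
    ext
    exact ((Category.id_comp _).trans (Category.comp_id _)).symm
  map₂_associator {W X Y Z} f g h := by
    ext
    change (α_ f.hom g.hom h.hom).hom = 𝟙 _ ≫ 𝟙 _ ▷ h.hom ≫ (α_ f.hom g.hom h.hom).hom ≫
      f.hom ◁ 𝟙 _ ≫ 𝟙 _
    simp
  map₂_left_unitor {X Y} f := by
    ext
    change (λ_ f.hom).hom = 𝟙 _ ≫ 𝟙 (𝟙 X.obj) ▷ f.hom ≫ (λ_ f.hom).hom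
    simp
  map₂_right_unitor {X Y} f := by
    ext
    change (ρ_ f.hom).hom = 𝟙 _ ≫ f.hom ◁ 𝟙 (𝟙 Y.obj) ≫ (ρ_ f.hom).hom
    simp

/-- The adjunction in the ambient bicategory underlying one in a locally full sub-bicategory. -/
def SubBicat.adjunction {K : Type u} [Bicategory.{w, v} K] {D : SubData K} {X Y : SubBicat D}
    {l : X ⟶ Y} {r : Y ⟶ X} (adj : l ⊣ r) : l.hom ⊣ r.hom where
  unit := adj.unit.hom
  counit := adj.counit.hom
  left_triangle := by
    have := congrArg SubBicat.Hom₂.hom adj.left_triangle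
    simp [leftZigzag, bicategoricalComp] at this ⊢
    exact this
  right_triangle := by
    have := congrArg SubBicat.Hom₂.hom adj.right_triangle
    simp [rightZigzag, bicategoricalComp] at this ⊢
    exact this

/-- An adjunction in the ambient bicategory, as one in a locally full sub-bicategory containing both
1-cells. -/
def SubBicat.adjunctionMk {K : Type u} [Bicategory.{w, v} K] {D : SubData K} {X Y : SubBicat D}
    {l : X ⟶ Y} {r : Y ⟶ X} (adj : l.hom ⊣ r.hom) : l ⊣ r where
  unit := ⟨adj.unit⟩
  counit := ⟨adj.counit⟩
  left_triangle := by
    have := adj.left_triangle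
    ext
    simp [leftZigzag, bicategoricalComp] at this ⊢
    exact this
  right_triangle := by
    have := adj.right_triangle
    ext
    simp [rightZigzag, bicategoricalComp] at this ⊢
    exact this

/-- An equivalence between objects of a locally full sub-bicategory, whose two 1-cells belong to
it. -/
def SubBicat.equivalenceMk {K : Type u} [Bicategory.{w, v} K] {D : SubData K} {X Y : SubBicat D}
    (e : X.obj ≌ Y.obj) (h : D.mor e.hom) (h' : D.mor e.inv) : X ≌ Y :=
  Equivalence.mkOfAdjointifyCounit (f := ⟨e.hom, h⟩) (g := ⟨e.inv, h'⟩)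
    (SubBicat.isoMk e.unit) (SubBicat.isoMk e.counit)

/-! ### KZ-doctrines as pseudofunctors -/

namespace KZDoctrine

variable {K : Type u} [Bicategory.{w, v} K] {small : K → Prop} (S : KZDoctrine K small)
  {X Y Z : Subtype small}

lemma extendsAlong_lan (f : X.1 ⟶ S.obj Y) : ExtendsAlong (S.unit X) (S.lan f) :=
  (isLeftExtension_iff_extendsAlong (S.cell f)).1 (S.isLeftExtension_cell f)

lemma extendsAlong_lan_comp (f : X.1 ⟶ S.obj Y) (g : Y.1 ⟶ S.obj Z) :
    ExtendsAlong (S.unit X) (S.lan f ≫ S.lan g) :=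
  (preservesExtension_iff (S.cell f) _).1 (S.preserves f g)

lemma extendsAlong_id (X : Subtype small) : ExtendsAlong (S.unit X) (𝟙 (S.obj X)) :=
  (isLeftExtension_iff_extendsAlong (ρ_ (S.unit X)).symm).1 (S.isLeftExtension_id X)

lemma extendsAlong_map (f : X.1 ⟶ Y.1) : ExtendsAlong (S.unit X) (S.map f) :=
  S.extendsAlong_lan _

lemma extendsAlong_map_comp (f : X.1 ⟶ Y.1) (g : Y.1 ⟶ Z.1) :
    ExtendsAlong (S.unit X) (S.map f ≫ S.map g) :=
  S.extendsAlong_lan_comp _ _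

lemma exists_map₂ {f g : X.1 ⟶ Y.1} (σ : f ⟶ g) : ∃ τ : S.map f ⟶ S.map g,
    S.unit X ◁ τ = (S.mapCell f).inv ≫ σ ▷ S.unit Y ≫ (S.mapCell g).hom :=
  (S.extendsAlong_map f _).2 _

/-- The action of a KZ-doctrine on 2-cells: the unique 2-cell `S f ⟶ S g` compatible with `σ` along
the units. -/
noncomputable def map₂ {f g : X.1 ⟶ Y.1} (σ : f ⟶ g) : S.map f ⟶ S.map g :=
  (S.exists_map₂ σ).choose

@[simp]
lemma unit_whiskerLeft_map₂ {f g : X.1 ⟶ Y.1} (σ : f ⟶ g) :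
    S.unit X ◁ S.map₂ σ = (S.mapCell f).inv ≫ σ ▷ S.unit Y ≫ (S.mapCell g).hom :=
  (S.exists_map₂ σ).choose_spec

lemma eq_map₂ {f g : X.1 ⟶ Y.1} {σ : f ⟶ g} {τ : S.map f ⟶ S.map g}
    (h : σ ▷ S.unit Y ≫ (S.mapCell g).hom = (S.mapCell f).hom ≫ S.unit X ◁ τ) :
    τ = S.map₂ σ :=
  (S.extendsAlong_map _ _).1 (by simp [h])

lemma exists_mapId (X : Subtype small) : ∃ i : S.map (𝟙 X.1) ≅ 𝟙 (S.obj X),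
    S.unit X ◁ i.hom = ((S.mapCell (𝟙 X.1)).symm ≪≫ λ_ _ ≪≫ (ρ_ _).symm).hom :=
  (S.extendsAlong_map _).exists_iso (S.extendsAlong_id X) _

/-- A KZ-doctrine preserves identities. -/
noncomputable def mapId (X : Subtype small) : S.map (𝟙 X.1) ≅ 𝟙 (S.obj X) :=
  (S.exists_mapId X).choose

@[simp]
lemma unit_whiskerLeft_mapId (X : Subtype small) : S.unit X ◁ (S.mapId X).hom =
    (S.mapCell (𝟙 X.1)).inv ≫ (λ_ _).hom ≫ (ρ_ _).inv :=
  (S.exists_mapId X).choose_spec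

lemma exists_mapComp (f : X.1 ⟶ Y.1) (g : Y.1 ⟶ Z.1) :
    ∃ i : S.map (X := X) (Y := Z) (f ≫ g) ≅ S.map f ≫ S.map g,
      S.unit X ◁ i.hom = ((S.mapCell (X := X) (Y := Z) (f ≫ g)).symm ≪≫ α_ _ _ _ ≪≫
        whiskerLeftIso f (S.mapCell g) ≪≫ (α_ _ _ _).symm ≪≫
          whiskerRightIso (S.mapCell f) (S.map g) ≪≫ α_ _ _ _).hom :=
  (S.extendsAlong_map _).exists_iso (S.extendsAlong_map_comp f g) _

/-- A KZ-doctrine preserves composition. -/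
noncomputable def mapComp (f : X.1 ⟶ Y.1) (g : Y.1 ⟶ Z.1) :
    S.map (X := X) (Y := Z) (f ≫ g) ≅ S.map f ≫ S.map g :=
  (S.exists_mapComp f g).choose

@[simp]
lemma unit_whiskerLeft_mapComp (f : X.1 ⟶ Y.1) (g : Y.1 ⟶ Z.1) :
    S.unit X ◁ (S.mapComp f g).hom = (S.mapCell (X := X) (Y := Z) (f ≫ g)).inv ≫ (α_ _ _ _).hom ≫
      f ◁ (S.mapCell g).hom ≫ (α_ _ _ _).inv ≫ (S.mapCell f).hom ▷ (S.map g) ≫ (α_ _ _ _).hom := by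
  refine (S.exists_mapComp f g).choose_spec.trans ?_
  simp

lemma unit_whiskerLeft_map_whiskerLeft (f : X.1 ⟶ Y.1) {A : K} {P Q : S.obj Y ⟶ A} (τ : P ⟶ Q) :
    S.unit X ◁ S.map f ◁ τ = (α_ _ _ _).inv ≫ (S.mapCell f).inv ▷ P ≫ (α_ _ _ _).hom ≫
      f ◁ S.unit Y ◁ τ ≫ (α_ _ _ _).inv ≫ (S.mapCell f).hom ▷ Q ≫ (α_ _ _ _).hom := by
  have := whisker_exchange (S.mapCell f).hom τ
  rw [← cancel_epi (α_ _ _ _).hom, ← cancel_epi ((S.mapCell f).hom ▷ P),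
    ← cancel_mono (α_ _ _ _).inv]
  simpa using this.symm

lemma map₂_comp {f g h : X.1 ⟶ Y.1} (σ : f ⟶ g) (τ : g ⟶ h) :
    S.map₂ (σ ≫ τ) = S.map₂ σ ≫ S.map₂ τ :=
  (S.extendsAlong_map f _).1 (by simp)

lemma map₂_whiskerLeft (f : X.1 ⟶ Y.1) {g h : Y.1 ⟶ Z.1} (σ : g ⟶ h) :
    S.map₂ (X := X) (Y := Z) (f ◁ σ) =
      (S.mapComp f g).hom ≫ S.map f ◁ S.map₂ σ ≫ (S.mapComp f h).inv := by
  rw [← Category.assoc, Iso.eq_comp_inv]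
  exact (S.extendsAlong_map _ _).1 (by simp [unit_whiskerLeft_map_whiskerLeft])

lemma map₂_whiskerRight {f g : X.1 ⟶ Y.1} (σ : f ⟶ g) (h : Y.1 ⟶ Z.1) :
    S.map₂ (X := X) (Y := Z) (σ ▷ h) =
      (S.mapComp f h).hom ≫ S.map₂ σ ▷ S.map h ≫ (S.mapComp g h).inv := by
  rw [← Category.assoc, Iso.eq_comp_inv]
  apply (S.extendsAlong_map _ _).1; dsimp only
  have e := whisker_assoc_symm (S.unit X) (S.map₂ σ) (S.map h)
  rw [unit_whiskerLeft_map₂] at e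
  have w := whisker_exchange σ (S.mapCell h).hom
  simp only [whiskerRight_comp] at w
  rw [← cancel_mono (α_ _ _ _).inv] at w
  simp only [Category.assoc, Iso.hom_inv_id, Category.comp_id] at w
  simp [e, reassoc_of% w]

lemma map₂_associator {W : Subtype small} (f : W.1 ⟶ X.1) (g : X.1 ⟶ Y.1) (h : Y.1 ⟶ Z.1) :
    S.map₂ (X := W) (Y := Z) (α_ f g h).hom =
      (S.mapComp (X := W) (Y := Y) (Z := Z) (f ≫ g) h).hom ≫ (S.mapComp f g).hom ▷ S.map h ≫
        (α_ _ _ _).hom ≫ S.map f ◁ (S.mapComp g h).inv ≫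
          (S.mapComp (X := W) (Y := X) (Z := Z) f (g ≫ h)).inv := by
  rw [← cancel_mono (S.mapComp (X := W) (Y := X) (Z := Z) f (g ≫ h)).hom,
    ← cancel_mono (S.map f ◁ (S.mapComp g h).hom)]
  apply (S.extendsAlong_map _ _).1; dsimp only
  have e := whisker_assoc_symm (S.unit W) (S.mapComp f g).hom (S.map h)
  rw [unit_whiskerLeft_mapComp] at e
  simp [unit_whiskerLeft_map_whiskerLeft, e]

lemma map₂_leftUnitor (f : X.1 ⟶ Y.1) : S.map₂ (λ_ f).hom =
    (S.mapComp (𝟙 X.1) f).hom ≫ (S.mapId X).hom ▷ S.map f ≫ (λ_ _).hom := by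
  apply (S.extendsAlong_map _ _).1; dsimp only
  have e := whisker_assoc_symm (S.unit X) (S.mapId X).hom (S.map f)
  rw [unit_whiskerLeft_mapId] at e
  simp [e]

lemma map₂_rightUnitor (f : X.1 ⟶ Y.1) : S.map₂ (ρ_ f).hom =
    (S.mapComp f (𝟙 Y.1)).hom ≫ S.map f ◁ (S.mapId Y).hom ≫ (ρ_ _).hom := by
  apply (S.extendsAlong_map _ _).1; dsimp only
  simp [unit_whiskerLeft_map_whiskerLeft]

/-- A KZ-doctrine as a pseudofunctor on its small objects. -/
noncomputable def toPseudofunctor : SubBicat (smallData small) ⥤ᵖ K where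
  obj X := S.obj ⟨X.obj, X.property⟩
  map {X Y} f := S.map (X := ⟨X.obj, X.property⟩) (Y := ⟨Y.obj, Y.property⟩) f.hom
  map₂ {X Y f g} σ := S.map₂ (X := ⟨X.obj, X.property⟩) (Y := ⟨Y.obj, Y.property⟩) σ.hom
  map₂_id {X Y} f := (S.extendsAlong_map _ _).1 (by simp)
  map₂_comp {X Y} f g h σ τ := S.map₂_comp _ _
  mapId X := S.mapId ⟨X.obj, X.property⟩
  mapComp {X Y Z} f g := S.mapComp (X := ⟨X.obj, X.property⟩) (Y := ⟨Y.obj, Y.property⟩)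
    (Z := ⟨Z.obj, Z.property⟩) f.hom g.hom
  map₂_whisker_left {X Y Z} f g h σ := S.map₂_whiskerLeft (X := ⟨X.obj, X.property⟩)
    (Y := ⟨Y.obj, Y.property⟩) (Z := ⟨Z.obj, Z.property⟩) f.hom σ.hom
  map₂_whisker_right {X Y Z f g} σ h := S.map₂_whiskerRight (X := ⟨X.obj, X.property⟩)
    (Y := ⟨Y.obj, Y.property⟩) (Z := ⟨Z.obj, Z.property⟩) σ.hom h.hom
  map₂_associator {W X Y Z} f g h := S.map₂_associator (W := ⟨W.obj, W.property⟩)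
    (X := ⟨X.obj, X.property⟩) (Y := ⟨Y.obj, Y.property⟩) (Z := ⟨Z.obj, Z.property⟩)
    f.hom g.hom h.hom
  map₂_left_unitor {X Y} f := S.map₂_leftUnitor (X := ⟨X.obj, X.property⟩)
    (Y := ⟨Y.obj, Y.property⟩) f.hom
  map₂_right_unitor {X Y} f := S.map₂_rightUnitor (X := ⟨X.obj, X.property⟩)
    (Y := ⟨Y.obj, Y.property⟩) f.hom

/-- If the units are fully faithful, then the doctrine is locally fully faithful. -/
lemma map₂_bijective (hY : IsRepFullyFaithful (S.unit Y)) (f g : X.1 ⟶ Y.1) :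
    Function.Bijective (S.map₂ : (f ⟶ g) → (S.map f ⟶ S.map g)) := by
  rw [← Function.Bijective.of_comp_iff' (S.extendsAlong_map f (S.map g))]
  have : (fun τ : S.map f ⟶ S.map g => S.unit X ◁ τ) ∘ S.map₂ =
      (fun σ => (S.mapCell f).symm.hom ≫ σ ≫ (S.mapCell g).hom) ∘
        (fun σ : f ⟶ g => σ ▷ S.unit Y) := by
    ext σ
    simp
  rw [this]
  exact (Iso.homCongr (S.mapCell f) (S.mapCell g)).bijective.comp
    (isRepFullyFaithful_iff.1 hY f g)

lemma cocomplete_obj (X : Subtype small) : S.Cocomplete (S.obj X) :=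
  fun _ l => ⟨S.lan l, S.cell l, S.isLeftExtension_cell l, fun _ f => S.preserves f l⟩

lemma isCell_of_adjunction {A B : K} {L : A ⟶ B} {R : B ⟶ A} (adj : L ⊣ R) : S.IsCell L :=
  fun _ _ _ _ hη => hη.preserves_of_adjunction adj

/-- Out of a cocomplete object, being a cell can be tested on the 1-cells that are left extensions
along units via the identity. -/
lemma isCell_iff {S : KZDoctrine K small} {A B : K} (hA : S.Cocomplete A) {f : A ⟶ B} :
    S.IsCell f ↔ ∀ (G : Subtype small) (L : S.obj G ⟶ A), ExtendsAlong (S.unit G) L →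
      ExtendsAlong (S.unit G) (L ≫ f) := by
  refine ⟨fun H G L hL => (preservesExtension_iff (Iso.refl _) f).1
    (H G _ L _ ((isLeftExtension_iff_extendsAlong (Iso.refl _)).2 hL)), fun H G l L η hη => ?_⟩
  obtain ⟨L', η', h', -⟩ := hA G l
  -- comparison with the invertible extension `η'` shows that `η` is invertible
  obtain ⟨i, rfl⟩ := h'.exists_iso hη
  exact (preservesExtension_iff (η' ≪≫ whiskerLeftIso (S.unit G) i) f).2
    (H G L (((isLeftExtension_iff_extendsAlong η').1 h').of_iso i))

lemma isCell_lan (g : Y.1 ⟶ S.obj Z) : S.IsCell (S.lan g) := by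
  refine (isCell_iff (S.cocomplete_obj Y)).2 fun G L hL => ?_
  obtain ⟨i, -⟩ := (S.extendsAlong_lan _).exists_iso hL (S.cell (S.unit G ≫ L)).symm
  exact (S.extendsAlong_lan_comp (S.unit G ≫ L) g).of_iso (whiskerRightIso i _)

/-- A left adjoint which climbs along the units is, up to isomorphism, an application of `S`. -/
lemma nonempty_iso_map_of_adjunction {L : S.obj X ⟶ S.obj Y} {R : S.obj Y ⟶ S.obj X} (adj : L ⊣ R)
    {l : X.1 ⟶ Y.1} (e : l ≫ S.unit Y ≅ S.unit X ≫ L) : Nonempty (S.map l ≅ L) :=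
  have H : ExtendsAlong (S.unit X) L :=
    ((S.extendsAlong_id X).comp_left_adjoint adj).of_iso (λ_ L)
  ⟨((S.extendsAlong_map l).exists_iso H ((S.mapCell l).symm ≪≫ e)).choose⟩

end KZDoctrine

/-! ### Cocomplete objects and cells -/

namespace KZDoctrine

variable {K : Type u} [Bicategory.{w, v} K] {small : K → Prop} (S : KZDoctrine K small)
  {X Y Z : Subtype small}

/-- A reflective subobject of a cocomplete object is cocomplete. -/
lemma Cocomplete.of_reflection {S : KZDoctrine K small} {A B : K} (hB : S.Cocomplete B)
    {L : B ⟶ A} {i : A ⟶ B} (adj : L ⊣ i) [IsIso adj.counit] : S.Cocomplete A := by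
  intro G l
  obtain ⟨M, η, hη, hM⟩ := hB G (l ≫ i)
  refine ⟨M ≫ L, (ρ_ l).symm ≪≫ whiskerLeftIso l (asIso adj.counit).symm ≪≫ (α_ _ _ _).symm ≪≫
    whiskerRightIso η L ≪≫ α_ _ _ _, ?_, fun D f => ?_⟩
  · rw [isLeftExtension_iff_extendsAlong] at hη ⊢
    exact hη.comp_left_adjoint adj
  · have := hM D f
    rw [preservesExtension_iff] at this ⊢
    exact (this.comp_left_adjoint adj).of_iso (α_ _ _ _)

lemma Cocomplete.of_equivalence {S : KZDoctrine K small} {A B : K} (hB : S.Cocomplete B)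
    (e : A ≌ B) : S.Cocomplete A :=
  have : IsIso (equivalenceSymmAdjunction e).counit := by
    rw [equivalenceSymmAdjunction_counit]
    infer_instance
  hB.of_reflection (equivalenceSymmAdjunction e)

/-- The unit of a cocomplete object has a left adjoint with invertible counit. -/
lemma Cocomplete.exists_adjunction {S : KZDoctrine K small} (hX : S.Cocomplete X.1) :
    ∃ (l : S.obj X ⟶ X.1) (adj : l ⊣ S.unit X), IsIso adj.counit := by
  obtain ⟨l, η, hη, -⟩ := hX X (𝟙 X.1)
  have hl := (isLeftExtension_iff_extendsAlong η).1 hη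
  obtain ⟨u, hu⟩ := (S.extendsAlong_id X (l ≫ S.unit X)).2
    ((ρ_ _).hom ≫ (λ_ _).inv ≫ η.hom ▷ S.unit X ≫ (α_ _ _ _).hom)
  dsimp at hu
  have h₁ : leftZigzag u η.inv = (λ_ l).hom ≫ (ρ_ l).inv := by
    rw [← cancel_epi (λ_ l).inv, ← cancel_mono (ρ_ l).hom]
    apply (hl _).1
    calc
      _ = 𝟙 _ ⊗≫ (S.unit X ◁ u) ▷ l ⊗≫ (S.unit X ≫ l) ◁ η.inv ⊗≫ 𝟙 _ := by
        bicategory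
      _ = 𝟙 _ ⊗≫ (η.hom ▷ (S.unit X ≫ l) ≫ (S.unit X ≫ l) ◁ η.inv) ⊗≫ 𝟙 _ := by
        rw [hu]; bicategory
      _ = 𝟙 _ ⊗≫ (η.inv ≫ η.hom) ⊗≫ 𝟙 _ := by
        rw [← whisker_exchange]; bicategory
      _ = _ := by
        rw [Iso.inv_hom_id]; bicategory
  have h₂ : rightZigzag u η.inv = (ρ_ _).hom ≫ (λ_ _).inv := by
    calc
      _ = 𝟙 _ ⊗≫ S.unit X ◁ u ⊗≫ η.inv ▷ S.unit X ⊗≫ 𝟙 _ := by bicategory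
      _ = 𝟙 _ ⊗≫ (η.hom ≫ η.inv) ▷ S.unit X ⊗≫ 𝟙 _ := by
        rw [hu]; bicategory
      _ = _ := by
        rw [Iso.hom_inv_id]; bicategory
  exact ⟨l, ⟨u, η.inv, h₁, h₂⟩, inferInstanceAs (IsIso η.inv)⟩

/-- A small object whose unit is fully faithful and has a left adjoint is cocomplete. -/
lemma cocomplete_of_adjunction (hX : IsRepFullyFaithful (S.unit X)) {l : S.obj X ⟶ X.1}
    (adj : l ⊣ S.unit X) : S.Cocomplete X.1 :=
  have := isIso_counit_of_fullyFaithful adj hX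
  (S.cocomplete_obj X).of_reflection adj

lemma nonempty_map_iso {f g : X.1 ⟶ Y.1} (e : f ≅ g) : Nonempty (S.map f ≅ S.map g) :=
  ⟨((S.extendsAlong_map f).exists_iso (S.extendsAlong_map g)
    ((S.mapCell f).symm ≪≫ whiskerRightIso e _ ≪≫ S.mapCell g)).choose⟩

lemma nonempty_map_adjunction {l : X.1 ⟶ Y.1} {r : Y.1 ⟶ X.1} (adj : l ⊣ r) :
    Nonempty (S.map l ⊣ S.map r) :=
  ⟨S.toPseudofunctor.mapAdjunction
    (SubBicat.adjunctionMk (D := smallData small) (X := ⟨X.1, X.2⟩) (Y := ⟨Y.1, Y.2⟩)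
      (l := ⟨l, trivial⟩) (r := ⟨r, trivial⟩) adj)⟩

/-- If the units are fully faithful, then the doctrine reflects adjunctions. -/
lemma nonempty_adjunction_of_map (hS : ∀ X, IsRepFullyFaithful (S.unit X)) {l : X.1 ⟶ Y.1}
    {r : Y.1 ⟶ X.1} (adj : S.map l ⊣ S.map r) : Nonempty (l ⊣ r) :=
  (GabrielUlmer.nonempty_adjunction_of_map S.toPseudofunctor (fun {A B} f g => by
    have := S.map₂_bijective (X := ⟨A.obj, A.property⟩) (Y := ⟨B.obj, B.property⟩) (hS _)
      f.hom g.hom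
    exact this.comp ⟨fun _ _ h => SubBicat.hom₂_ext h, fun σ => ⟨⟨σ⟩, rfl⟩⟩)
    (X := (⟨X.1, X.2⟩ : SubBicat (smallData small))) (Y := ⟨Y.1, Y.2⟩)
    (l := ⟨l, trivial⟩) (r := ⟨r, trivial⟩) adj).map SubBicat.adjunction

/-- On a cell `f` between cocomplete small objects, the left adjoints of the units form a square
that commutes up to isomorphism. -/
lemma nonempty_square_iso (hX : S.Cocomplete X.1) {l : S.obj X ⟶ X.1} (adj : l ⊣ S.unit X)
    {l' : S.obj Y ⟶ Y.1} (adj' : l' ⊣ S.unit Y) [IsIso adj.counit] [IsIso adj'.counit]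
    {f : X.1 ⟶ Y.1} (hf : S.IsCell f) : Nonempty (S.map f ≫ l' ≅ l ≫ f) := by
  have h₁ : ExtendsAlong (S.unit X) (l ≫ f) :=
    (isCell_iff hX).1 hf X l (((S.extendsAlong_id X).comp_left_adjoint adj).of_iso (λ_ l))
  have h₂ : ExtendsAlong (S.unit X) (S.map f ≫ l') := (S.extendsAlong_map f).comp_left_adjoint adj'
  exact ⟨(h₂.exists_iso h₁ ((α_ _ _ _).symm ≪≫ whiskerRightIso (S.mapCell f).symm l' ≪≫
    α_ _ _ _ ≪≫ whiskerLeftIso f (asIso adj'.counit) ≪≫ ρ_ f ≪≫ (λ_ f).symm ≪≫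
      whiskerRightIso (asIso adj.counit).symm f ≪≫ α_ _ _ _)).choose⟩

/-- Out of a cocomplete small object, a 1-cell is a cell as soon as its composites with the
reflected free extensions are extensions. -/
lemma isCell_of_extendsAlong (hX : S.Cocomplete X.1) {l : S.obj X ⟶ X.1} (adj : l ⊣ S.unit X)
    [IsIso adj.counit] {B : K} {f : X.1 ⟶ B}
    (H : ∀ (D : Subtype small) (k : D.1 ⟶ X.1), ExtendsAlong (S.unit D) (S.map k ≫ l ≫ f)) :
    S.IsCell f := by
  refine (isCell_iff hX).2 fun D L hL => ?_
  obtain ⟨i, -⟩ := ((S.extendsAlong_map (S.unit D ≫ L)).comp_left_adjoint adj).exists_iso hL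
    ((α_ _ _ _).symm ≪≫ whiskerRightIso (S.mapCell _).symm l ≪≫ α_ _ _ _ ≪≫
      whiskerLeftIso _ (asIso adj.counit) ≪≫ ρ_ _)
  exact (H D (S.unit D ≫ L)).of_iso ((α_ _ _ _).symm ≪≫ whiskerRightIso i f)

end KZDoctrine

/-! ### Yoneda contexts -/

section

variable {K : Type u} [Bicategory.{w, v} K]

lemma IsAbsLeftLifting.existsUnique {X Y Z : K} {f : Y ⟶ Z} {g : X ⟶ Z} {h : X ⟶ Y}
    {η : g ⟶ h ≫ f} (H : IsAbsLeftLifting η) {T : K} (t : T ⟶ X) (k : T ⟶ Y)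
    (σ : t ≫ g ⟶ k ≫ f) : ∃! τ : t ≫ h ⟶ k, (t ◁ η ≫ (α_ t h f).inv) ≫ τ ▷ f = σ := by
  obtain ⟨H⟩ := H t
  exact ⟨H.desc (LeftLift.mk k σ), H.fac (LeftLift.mk k σ),
    fun τ hτ => H.hom_ext (hτ.trans (H.fac (LeftLift.mk k σ)).symm)⟩

end

namespace YonedaContext

variable {K : Type u} [Bicategory.{w, v} K] (c : YonedaContext K) (X Y : Subtype c.small)

/-- Yoneda maps are fully faithful: `χ` at an identity exhibits both a left extension along an
identity, so that it is invertible and `y` is the nerve of the identity, and an absolute left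
lifting of `y` along this nerve. -/
lemma yoneda_fullyFaithful : IsRepFullyFaithful (c.P.unit X) := by
  have hχ := c.yoneda.chi_isLeftExtension (𝟙 X.1) (c.adm_of_small _)
  have h₁ : IsLeftExtension (λ_ (c.P.unit X)).symm.hom :=
    (isLeftExtension_iff_extendsAlong (λ_ (c.P.unit X)).symm).2 (GabrielUlmer.extendsAlong_id _)
  obtain ⟨i, hi⟩ := h₁.exists_iso hχ
  have : IsIso (c.yoneda.chi (𝟙 X.1) (c.adm_of_small _)) := by
    rw [← hi]; infer_instance
  refine IsRepFullyFaithful.of_iso ?_ i.symm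
  refine isRepFullyFaithful_iff.2 fun {T} a b => ?_
  rw [Function.bijective_iff_existsUnique]
  intro σ
  obtain ⟨τ, h, h'⟩ := IsAbsLeftLifting.existsUnique
    (c.yoneda.chi_isAbsLeftLifting (𝟙 X.1) (c.adm_of_small _)) a b
      ((a ◁ c.yoneda.chi (𝟙 X.1) (c.adm_of_small _) ≫ (α_ _ _ _).inv) ≫ (ρ_ a).hom ▷ _ ≫ σ)
  rw [cancel_epi] at h
  refine ⟨(ρ_ a).inv ≫ τ, by simp [h], fun τ' ht => ?_⟩
  rw [Iso.eq_inv_comp]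
  apply h'
  simp [← ht]

/-- The Yoneda extension of a 1-cell into `P Y` is left adjoint to its nerve. -/
lemma nonempty_lan_adjunction {X Y : Subtype c.small} (k : X.1 ⟶ c.P.obj Y) :
    Nonempty (c.P.lan k ⊣ c.yoneda.nerve k (c.adm_of_small k)) :=
  c.has_nerve k (c.P.lan k) (c.P.cell k).hom (c.P.cocomplete_obj Y) (c.P.isLeftExtension_cell k)

/-- The 1-cells `P f` have right adjoints, which are in turn left adjoints: the nerve of `f ≫ y` is
also the extension of the nerve of `f` along the Yoneda map, as both are left extensions of `y`
along `f ≫ y`. -/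
lemma exists_map_adjunction {X Y : Subtype c.small} (f : X.1 ⟶ Y.1) :
    ∃ (F : c.P.obj Y ⟶ c.P.obj X) (F' : c.P.obj X ⟶ c.P.obj Y),
      Nonempty (c.P.map f ⊣ F) ∧ Nonempty (F ⊣ F') := by
  obtain ⟨a₁⟩ := c.nonempty_lan_adjunction (f ≫ c.P.unit Y)
  obtain ⟨a₂⟩ := c.nonempty_lan_adjunction (c.yoneda.nerve f (c.adm_of_small f))
  have h := (c.yoneda.chi_isLeftExtension f (c.adm_of_small f)).comp
    (c.P.extendsAlong_lan (c.yoneda.nerve f (c.adm_of_small f))) (c.P.cell _)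
  obtain ⟨i⟩ := h.nonempty_iso (c.yoneda.chi_isLeftExtension (f ≫ c.P.unit Y) (c.adm_of_small _))
    (Iso.refl _)
  exact ⟨_, _, ⟨a₁⟩, ⟨adjunctionOfIsoLeft a₂ i⟩⟩

end YonedaContext

/-! ### Gabriel-Ulmer envelopes -/

namespace GUEnvelope

variable {K : Type u} [Bicategory.{w, v} K] {c : YonedaContext K} (E : GUEnvelope c)

/-- The value of the envelope at a small object, as a small object. -/
abbrev hatObj (X : Subtype c.small) : Subtype c.small := ⟨E.hat.obj X, E.small_hat X⟩

/-- The unit of the envelope, as a 1-cell between small objects. -/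
abbrev hatUnit (X : Subtype c.small) : X.1 ⟶ (E.hatObj X).1 := E.hat.unit X

/-- The action of the envelope on a 1-cell, as a 1-cell between small objects. -/
abbrev hatMap {X Y : Subtype c.small} (f : X.1 ⟶ Y.1) : (E.hatObj X).1 ⟶ (E.hatObj Y).1 :=
  E.hat.map f

/-- The comparison `J` is, up to isomorphism, the image under `S` of the unit of the envelope
followed by the equivalence `S X̂ ≌ P X`. -/
lemma nonempty_map_unit_iso_J (X : Subtype c.small) :
    Nonempty (c.S.map (E.hatUnit X) ≫ (E.equiv X).hom ≅ c.J X) := by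
  have h : ExtendsAlong (c.S.unit X) (c.S.map (E.hatUnit X) ≫ (E.equiv X).hom) :=
    (c.S.extendsAlong_map _).comp_left_adjoint (equivalenceAdjunction _)
  let e : c.P.unit X ≅ c.S.unit X ≫ c.S.map (E.hatUnit X) ≫ (E.equiv X).hom :=
    (E.unitIso X).symm ≪≫ (α_ _ _ _).symm ≪≫ whiskerRightIso (c.S.mapCell (E.hatUnit X)) _ ≪≫
      α_ _ _ _
  exact ((isLeftExtension_iff_extendsAlong e).2 h).nonempty_iso (c.chi_isLeftExtension X)
    (Iso.refl _)

lemma map_unit_equiv_fullyFaithful (X : Subtype c.small) :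
    IsRepFullyFaithful (c.S.map (E.hatUnit X) ≫ (E.equiv X).hom) :=
  (c.J_fullyFaithful X).of_iso (E.nonempty_map_unit_iso_J X).some.symm

lemma map_unit_fullyFaithful (X : Subtype c.small) :
    IsRepFullyFaithful (c.S.map (E.hatUnit X)) :=
  (E.map_unit_equiv_fullyFaithful X).of_comp (.of_equivalence _)

/-- The units of `S` are fully faithful, as they become Yoneda maps after composition with the fully
faithful `J`. -/
lemma unit_fullyFaithful (E : GUEnvelope c) (X : Subtype c.small) :
    IsRepFullyFaithful (c.S.unit X) := by
  refine IsRepFullyFaithful.of_comp ?_ (E.map_unit_equiv_fullyFaithful X)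
  exact (c.yoneda_fullyFaithful X).of_iso ((E.unitIso X).symm ≪≫ (α_ _ _ _).symm ≪≫
    whiskerRightIso (c.S.mapCell (E.hatUnit X)) _ ≪≫ α_ _ _ _)

lemma hat_unit_fullyFaithful (X : Subtype c.small) : IsRepFullyFaithful (E.hat.unit X) :=
  ((c.yoneda_fullyFaithful X).of_iso (E.unitIso X).symm).of_comp
    ((E.unit_fullyFaithful _).comp (.of_equivalence _))

lemma exists_map_hatMap_adjunction {X Y : Subtype c.small} (f : X.1 ⟶ Y.1) :
    ∃ (F : c.S.obj (E.hatObj Y) ⟶ c.S.obj (E.hatObj X))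
      (F' : c.S.obj (E.hatObj X) ⟶ c.S.obj (E.hatObj Y)),
      Nonempty (c.S.map (E.hatMap f) ⊣ F) ∧ Nonempty (F ⊣ F') := by
  obtain ⟨F, F', ⟨a⟩, ⟨a'⟩⟩ := c.exists_map_adjunction f
  obtain ⟨n⟩ := E.naturality f
  refine ⟨_, _, ⟨adjunctionOfIsoLeft (((equivalenceAdjunction (E.equiv X)).comp a).comp
    (equivalenceSymmAdjunction (E.equiv Y))) ?_⟩, ⟨(equivalenceAdjunction (E.equiv Y)).comp
      (a'.comp (equivalenceSymmAdjunction (E.equiv X)))⟩⟩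
  exact whiskerRightIso n.symm _ ≪≫ α_ _ _ _ ≪≫ whiskerLeftIso _ (E.equiv Y).unit.symm ≪≫ ρ_ _

/-- A 1-cell `m : X̂ ⟶ Y` is the left extension of its restriction along the unit `X ⟶ X̂` when it
climbs to a left adjoint `S X̂ ⟶ S Y`: transporting along `S X̂ ≌ P X`, this follows from
`P X` being free under the Yoneda map, as all the units are fully faithful. -/
lemma extendsAlong_hat_unit {X Y : Subtype c.small} (m : (E.hatObj X).1 ⟶ Y.1)
    {a : c.S.obj (E.hatObj X) ⟶ c.S.obj Y} {r : c.S.obj Y ⟶ c.S.obj (E.hatObj X)} (adj : a ⊣ r)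
    (e : m ≫ c.S.unit Y ≅ c.S.unit (E.hatObj X) ≫ a) : ExtendsAlong (E.hatUnit X) m := by
  intro k
  let b := c.S.lan (X := E.hatObj X) (k ≫ c.S.unit Y)
  let i (x : c.S.obj (E.hatObj X) ⟶ c.S.obj Y) :
      (E.equiv X).hom ≫ (E.equiv X).inv ≫ x ≅ x :=
    (α_ _ _ _).symm ≪≫ whiskerRightIso (E.equiv X).unit.symm x ≪≫ λ_ x
  have h₁ : ExtendsAlong (c.P.unit X) ((E.equiv X).inv ≫ a) :=
    ((c.P.extendsAlong_id X).comp_left_adjoint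
      ((equivalenceSymmAdjunction (E.equiv X)).comp adj)).of_iso (λ_ _)
  have h₂ := whiskerLeft_bijective_of_comp
    (h₁.of_iso_left ((E.unitIso X).symm ≪≫ (α_ _ _ _).symm) ((E.equiv X).inv ≫ b))
    (extendsAlong_equivalence (E.equiv X) _ _)
  have h₃ := whiskerLeft_bijective_of_comp (whiskerLeft_bijective_of_iso (i a) (i b) h₂)
    (((c.S.extendsAlong_id _).comp_left_adjoint adj).of_iso (λ_ _) b)
  have h₄ := whiskerLeft_bijective_of_iso e.symm
    (c.S.cell (X := E.hatObj X) (k ≫ c.S.unit Y)).symm h₃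
  have hY {T : K} (p q : T ⟶ Y.1) :=
    isRepFullyFaithful_iff.1 (E.unit_fullyFaithful Y) p q
  have h₅ : (fun τ : m ≫ c.S.unit Y ⟶ k ≫ c.S.unit Y => E.hatUnit X ◁ τ) ∘
      (fun τ : m ⟶ k => τ ▷ c.S.unit Y) =
      (fun τ => (α_ _ _ _).inv ≫ τ ≫ (α_ _ _ _).hom) ∘
        (fun τ : E.hatUnit X ≫ m ⟶ E.hatUnit X ≫ k => τ ▷ c.S.unit Y) ∘
          (fun τ : m ⟶ k => E.hatUnit X ◁ τ) := by
    ext τ; simp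
  have h₆ := h₄.comp (hY m k)
  rw [h₅] at h₆
  exact (Function.Bijective.of_comp_iff' (hY _ _) _).1 ((Function.Bijective.of_comp_iff'
    (Iso.homCongr (α_ _ _ _) (α_ _ _ _)).bijective _).1 h₆)

end GUEnvelope

/-! ### Objects and 1-cells of the duality -/

namespace GUEnvelope

variable {K : Type u} [Bicategory.{w, v} K] {c : YonedaContext K} (E : GUEnvelope c)

/-- For a cell `f : X ⟶ Y` of the envelope between cocomplete objects, `S f` has a right adjoint
which is an `S`-cell: as `S X` is a reflective subobject of `S X̂`, it suffices that the reflection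
`S X̂ ⟶ S X` followed by `S f` has one, and this composite is `S f̂` followed by the reflection
`S Ŷ ⟶ S Y`. -/
lemma exists_right_adjoint {X Y : Subtype c.small} (hX : E.hat.Cocomplete X.1)
    (hY : E.hat.Cocomplete Y.1) {f : X.1 ⟶ Y.1} (hf : E.hat.IsCell f) :
    ∃ r : c.S.obj Y ⟶ c.S.obj X, Nonempty (c.S.map f ⊣ r) ∧ c.S.IsCell r := by
  obtain ⟨l, adj, _⟩ := KZDoctrine.Cocomplete.exists_adjunction hX
  obtain ⟨l', adj', _⟩ := KZDoctrine.Cocomplete.exists_adjunction hY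
  obtain ⟨i⟩ := E.hat.nonempty_square_iso hX adj adj' hf
  obtain ⟨F, F', ⟨a⟩, ⟨a'⟩⟩ := E.exists_map_hatMap_adjunction f
  obtain ⟨Sadj⟩ := c.S.nonempty_map_adjunction (X := E.hatObj X) (Y := X) adj
  obtain ⟨Sadj'⟩ := c.S.nonempty_map_adjunction (X := E.hatObj Y) (Y := Y) adj'
  have := isIso_counit_of_fullyFaithful Sadj (E.map_unit_fullyFaithful X)
  obtain ⟨j⟩ := c.S.nonempty_map_iso (X := E.hatObj X) (Y := Y) i
  obtain ⟨θ⟩ := nonempty_adjunction_of_reflection Sadj (adjunctionOfIsoLeft (a.comp Sadj')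
    ((c.S.mapComp (X := E.hatObj X) (Y := E.hatObj Y) (Z := Y) (E.hatMap f) l').symm ≪≫ j ≪≫
      c.S.mapComp (X := E.hatObj X) (Y := X) (Z := Y) l f))
  exact ⟨_, ⟨θ⟩, c.S.isCell_comp (c.S.isCell_comp (c.S.isCell_lan _) (c.S.isCell_of_adjunction a'))
    (c.S.isCell_of_adjunction Sadj)⟩

/-- If `X` is cocomplete for the envelope, then `S X` is presentable. -/
lemma presentable_obj {X : Subtype c.small} (hX : E.hat.Cocomplete X.1) :
    c.Presentable (c.S.obj X) := by
  obtain ⟨l, adj, _⟩ := KZDoctrine.Cocomplete.exists_adjunction hX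
  obtain ⟨Sadj⟩ := c.S.nonempty_map_adjunction (X := E.hatObj X) (Y := X) adj
  refine ⟨X, _, _, (equivalenceSymmAdjunction (E.equiv X)).comp Sadj,
    isIso_counit_of_fullyFaithful _ (E.map_unit_equiv_fullyFaithful X), X, .id _, ?_⟩
  refine (isLeftExtension_iff_extendsAlong (Iso.refl _)).2 ?_
  exact ((c.S.extendsAlong_map _).comp_left_adjoint
    (equivalenceAdjunction (E.equiv X))).of_iso (λ_ _).symm

/-- Every presentable object is equivalent to some `S X` with `X` cocomplete for the envelope. -/
lemma exists_equivalence_of_presentable (hS : c.S.Climbable) {A : K} (hA : c.Presentable A) :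
    ∃ X : Subtype c.small, E.hat.Cocomplete X.1 ∧ Nonempty (c.S.obj X ≌ A) := by
  obtain ⟨G, L, i, adj, _, X, e, -⟩ := hA
  refine ⟨X, ?_, ⟨e⟩⟩
  have hP : c.P.Cocomplete (c.S.obj X) :=
    ((c.P.cocomplete_obj G).of_reflection adj).of_equivalence e
  -- the unit `X ⟶ S X` has a Yoneda extension, which is left adjoint to its nerve `J`
  obtain ⟨L₁, η, hη, -⟩ := hP X (c.S.unit X)
  obtain ⟨adj₁⟩ := c.has_nerve _ _ _ hP hη
  obtain ⟨j⟩ := (c.yoneda.chi_isLeftExtension (c.S.unit X) (c.adm_of_small _)).nonempty_iso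
    (c.chi_isLeftExtension X) (Iso.refl _)
  obtain ⟨j'⟩ := E.nonempty_map_unit_iso_J X
  have adj₂ : (E.equiv X).hom ≫ L₁ ⊣ c.S.map (X := X) (Y := E.hatObj X) (E.hatUnit X) :=
    adjunctionOfIsoRight ((equivalenceAdjunction (E.equiv X)).comp adj₁)
      (whiskerRightIso (j ≪≫ j'.symm) _ ≪≫ α_ _ _ _ ≪≫ whiskerLeftIso _ (E.equiv X).unit.symm ≪≫
        ρ_ _)
  -- the left adjoint of `S X ⟶ S X̂` climbs to a left adjoint of the unit `X ⟶ X̂`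
  obtain ⟨l, ⟨k⟩⟩ := hS _ _ _ _ ⟨adj₂⟩ (c.S.isCell_lan _)
  obtain ⟨m⟩ := c.S.nonempty_iso_map_of_adjunction adj₂ k
  obtain ⟨adj₃⟩ := c.S.nonempty_adjunction_of_map E.unit_fullyFaithful
    (adjunctionOfIsoLeft adj₂ m.symm)
  exact E.hat.cocomplete_of_adjunction (E.hat_unit_fullyFaithful X) adj₃

/-- Every `S`-cell `S Y ⟶ S X` with a left adjoint is the right adjoint of some `S f`, with `f` a
cell for the envelope. -/
lemma exists_isCell_of_adjunction (hS : c.S.Climbable) {X Y : Subtype c.small}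
    (hX : E.hat.Cocomplete X.1) {L : c.S.obj X ⟶ c.S.obj Y} {R : c.S.obj Y ⟶ c.S.obj X}
    (adj : L ⊣ R) (hR : c.S.IsCell R) :
    ∃ f : X.1 ⟶ Y.1, E.hat.IsCell f ∧ Nonempty (c.S.map f ≅ L) := by
  obtain ⟨f, ⟨e⟩⟩ := hS _ _ L R ⟨adj⟩ hR
  refine ⟨f, ?_, c.S.nonempty_iso_map_of_adjunction adj e⟩
  obtain ⟨l, adj₁, _⟩ := KZDoctrine.Cocomplete.exists_adjunction hX
  obtain ⟨adj₂⟩ := c.S.nonempty_map_adjunction (X := E.hatObj X) (Y := X) adj₁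
  refine E.hat.isCell_of_extendsAlong hX adj₁ fun D k => ?_
  obtain ⟨F, F', ⟨a⟩, -⟩ := E.exists_map_hatMap_adjunction k
  refine E.extendsAlong_hat_unit (Y := Y) _ (a.comp (adj₂.comp adj)) ?_
  exact α_ _ _ _ ≪≫ whiskerLeftIso _ (α_ _ _ _ ≪≫ whiskerLeftIso _ e ≪≫ (α_ _ _ _).symm ≪≫
    whiskerRightIso (c.S.mapCell (X := E.hatObj X) (Y := X) l) L ≪≫ α_ _ _ _) ≪≫
    (α_ _ _ _).symm ≪≫ whiskerRightIso (c.S.mapCell (X := E.hatObj D) (Y := E.hatObj X)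
      (E.hatMap k)) _ ≪≫ α_ _ _ _

end GUEnvelope

/-! ### The pseudofunctor of models -/

namespace GUEnvelope

variable {K : Type u} [Bicategory.{w, v} K] {c : YonedaContext K} (E : GUEnvelope c)

/-- The action of `S` on `Rex(J)`. -/
noncomputable def applyS : E.Rex ⥤ᵖ K :=
  (SubBicat.inclusion (D' := smallData c.small) (fun _ (h : c.small _ ∧ _) => h.1)
    (fun _ _ => trivial)).comp c.S.toPseudofunctor

/-- A right adjoint of `S f`, for a 1-cell `f` of `Rex(J)`. -/
noncomputable def modMap {X Y : E.Rex} (f : X ⟶ Y) : E.applyS.obj Y ⟶ E.applyS.obj X :=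
  (E.exists_right_adjoint (X := X.toSmall) (Y := Y.toSmall) X.property.2 Y.property.2
    f.mem).choose

lemma isCell_modMap {X Y : E.Rex} (f : X ⟶ Y) : c.S.IsCell (E.modMap f) :=
  (E.exists_right_adjoint (X := X.toSmall) (Y := Y.toSmall) X.property.2 Y.property.2
    f.mem).choose_spec.2

/-- The adjunction between `S f` and its right adjoint. -/
noncomputable def modAdjunction {X Y : E.Rex} (f : X ⟶ Y) : E.applyS.map f ⊣ E.modMap f :=
  (E.exists_right_adjoint (X := X.toSmall) (Y := Y.toSmall) X.property.2 Y.property.2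
    f.mem).choose_spec.1.some

/-- The pseudofunctor `J-Mod`, which sends `X` to `S X` and `f` to a right adjoint of `S f`. -/
noncomputable def mod : Coop E.Rex ⥤ᵖ c.Lp :=
  rightAdjointPseudofunctor E.applyS E.modMap E.modAdjunction
    (fun X => E.presentable_obj (X := X.toSmall) X.property.2)
    (fun f => ⟨⟨_, ⟨E.modAdjunction f⟩⟩, E.isCell_modMap f⟩)

lemma isGivenByApplying_mod : IsGivenByApplying E E.mod := by
  refine ⟨fun G => .id _, fun {G G'} f => adjunctionOfIsoLeft (E.modAdjunction f)
    ((ρ_ _).symm ≪≫ (λ_ _).symm), fun {G G' f f'} σ τ h => ?_⟩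
  obtain rfl := c.S.eq_map₂ (X := G.toSmall) (Y := G'.toSmall) h
  refine (conjugateEquiv_adjunctionOfIsoLeft (E.modAdjunction f') _ (E.modAdjunction f) _
    (E.applyS.map₂ σ)).symm.trans (congrArg _ ?_)
  have key {A B : K} {p q : A ⟶ B} (θ : p ⟶ q) :
      ((λ_ (p ≫ 𝟙 B)).hom ≫ (ρ_ p).hom) ≫ θ ≫ (ρ_ q).inv ≫ (λ_ (q ≫ 𝟙 B)).inv =
        𝟙 A ◁ (θ ▷ 𝟙 B) := by
    bicategory
  exact key _

lemma mapFunctor_mod_isEquivalence (hS : c.S.Climbable) (X Y : Coop E.Rex) :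
    (E.mod.mapFunctor X Y).IsEquivalence := by
  refine rightAdjointPseudofunctor_isEquivalence (D := c.lpData) E.applyS E.modMap E.modAdjunction _
    (fun f => ⟨⟨_, ⟨E.modAdjunction f⟩⟩, E.isCell_modMap f⟩) (fun {X Y} f g => ?_)
    (fun {X Y} s hs => ?_) X Y
  · exact (c.S.map₂_bijective (X := X.toSmall) (Y := Y.toSmall) (E.unit_fullyFaithful _)
      f.hom g.hom).comp ⟨fun _ _ h => SubBicat.hom₂_ext h, fun σ => ⟨⟨σ⟩, rfl⟩⟩
  · obtain ⟨⟨L, ⟨adj⟩⟩, hs⟩ := hs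
    obtain ⟨f, hf, ⟨i⟩⟩ := E.exists_isCell_of_adjunction (X := X.toSmall) (Y := Y.toSmall) hS
      X.property.2 adj hs
    exact ⟨⟨f, hf⟩, ⟨rightAdjointIso (E.modAdjunction ⟨f, hf⟩) adj i⟩⟩

lemma exists_mod_obj_equivalence (hS : c.S.Climbable) (A : c.Lp) :
    ∃ X : Coop E.Rex, Nonempty (E.mod.obj X ≌ A) := by
  obtain ⟨X, hX, ⟨e⟩⟩ := E.exists_equivalence_of_presentable hS A.property
  exact ⟨⟨⟨X.1, X.2, hX⟩⟩, ⟨SubBicat.equivalenceMk e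
    ⟨⟨_, ⟨equivalenceSymmAdjunction e⟩⟩, c.S.isCell_of_adjunction (equivalenceAdjunction e)⟩
    ⟨⟨_, ⟨equivalenceAdjunction e⟩⟩, c.S.isCell_of_adjunction (equivalenceSymmAdjunction e)⟩⟩⟩

end GUEnvelope

end GabrielUlmer

theorem theorem4p12 {K : Type u} [Bicategory.{w, v} K]
    (J : GabrielUlmer.YonedaContext K) (hS : J.S.Climbable)
    (E : GabrielUlmer.GUEnvelope J) (hE : E.Absorbing) :
    ∃ (Mod : GabrielUlmer.Coop E.Rex ⥤ᵖ J.Lp) (Th : J.Lp ⥤ᵖ GabrielUlmer.Coop E.Rex)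
      (b : GabrielUlmer.Biadjunction Mod Th),
      GabrielUlmer.IsGivenByApplying E Mod ∧ b.IsBiequivalence := by
  obtain ⟨Th, b, hb⟩ := GabrielUlmer.exists_biadjunction_isBiequivalence E.mod
    (E.mapFunctor_mod_isEquivalence hS) (E.exists_mod_obj_equivalence hS)
  exact ⟨E.mod, Th, b, E.isGivenByApplying_mod, hb⟩
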